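/- Let $M$ be a smooth manifold (Hausdorff, second countable) and let $(E,[-,-]_D,\rho,\langle-,-\rangle)$ be a Courant algebroid over $M$: $\langle-,-\rangle$ is a non-degenerate symmetric fibre metric of any signature, $\rho:E\to TM$ is a bundle map, and the Dorfman bracket satisfies the Leibniz identity, $\rho([e_1,e_2]_D)=[\rho(e_1),\rho(e_2)]$, $[e_1,fe_2]_D=f[e_1,e_2]_D+(\rho(e_1)f)e_2$, $\langle[e,e]_D,x\rangle=\tfrac12\rho(x)\langle e,e\rangle$ and $\rho(e_1)\langle e_2,e_3\rangle=\langle[e_1,e_2]_D,e_3\rangle+\langle e_2,[e_1,e_3]_D\rangle$. Let $D$ be a linear connection on $E$ preserving $\langle-,-\rangle$, with curvature $R(u,v)=[D_u,D_v]-D_{[u,v]}$, and let $g$ be a (pseudo-)Riemannian metric on $M$ with ${}^EDg=0$, where ${}^ED_ev=[\rho(e),v]+\rho(D_ve)$ for $e\in\Gamma(E)$, $v\in\mathfrak X(M)$. With $[-,-]_C$ the skew-symmetrization of $[-,-]_D$, let $$T(e_1,e_2,e_3)=-\tfrac12\langle D_{\rho(e_1)}e_2-D_{\rho(e_2)}e_1,e_3\rangle+\tfrac13\langle[e_1,e_2]_C,e_3\rangle+\mathrm{cycl}(1,2,3)$$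 be the $E$-torsion and let the basic curvature $S$ be given by $$\langle S(v;e_1,e_2),e_3\rangle=(D_vT)(e_1,e_2,e_3)+\langle R(v,\rho(e_1))e_2,e_3\rangle+\langle R(v,\rho(e_2))e_3,e_1\rangle+\langle R(v,\rho(e_3))e_1,e_2\rangle .$$ The phase space $T^*[2]E[1]$ has local Darboux coordinates $(x^i,p_i,\eta^a)$ of degrees $(0,2,1)$, attached to local coordinates $x^i$ of $M$ and a local frame $e_a$ of $E$ with constant $k_{ab}=\langle e_a,e_b\rangle$; its graded Poisson bracket is given by $\{x^i,p_j\}=\delta^i_j$, $\{\eta^a,\eta^b\}=k^{ab}$, all other brackets of coordinates being zero. Write $\rho(e_a)=\rho^i_a\partial_i$, $f_{abc}=\langle[e_a,e_b]_D,e_c\rangle$, $\Gamma_{abi}=\langle D_{\partial_i}e_a,e_b\rangle$, $p^\nabla_i=p_i+\tfrac12\Gamma_{abi}\eta^a\eta^b$, and for $U\in\Gamma(\wedge^4E^*)$ put $$S_{BFV}=\eta^a\rho^i_ap_i+\tfrac1{3!}f_{abc}\eta^a\eta^b\eta^c,\qquad H_{BFV}=\tfrac12g^{ij}p^\nabla_ip^\nabla_j+\tfrac1{4!}U_{abcd}\eta^a\eta^b\eta^c\eta^d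 .$$ If $(E,D)$ is a Cartan Courant algebroid, i.e. $S=0$, then $U=0$ gives a solution of the BFV master equations: for $U=0$ the local expressions for $S_{BFV}$ and $H_{BFV}$ in all Darboux coordinate systems define global functions on $T^*[2]E[1]$, and $$\{S_{BFV},S_{BFV}\}=0,\qquad\{S_{BFV},H_{BFV}\}=0,\qquad\{H_{BFV},H_{BFV}\}=0 .$$ -/

import Mathlib

open scoped Manifold ContDiff TensorProduct

noncomputable section

/-! ### Courant algebroids, connections, torsion and basic curvature

Everything is expressed through global sections: `A` is the algebra `C^∞(M)`, `Γ` the `A`-module of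
smooth sections of `E → M`, and vector fields are the derivations of `A`. Bundle maps are
`A`-linear maps of sections, and a fibrewise non-degenerate form is one inducing an isomorphism
of the module of sections with its `A`-dual. -/

section Algebraic

variable (A Γ : Type*) [CommRing A] [Algebra ℝ A] [AddCommGroup Γ] [Module ℝ Γ] [Module A Γ]

/-- Vector fields. -/
abbrev VectorFields := Derivation ℝ A A

/-- A Courant algebroid with (non-skew) Dorfman bracket. The last axiom but one is
`[e, e] = 𝒟⟨e, e⟩` with `⟨𝒟 f, x⟩ = ½ ρ(x) f`. -/
structure CourantAlgebroid where
  /-- the Dorfman bracket -/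
  dorfman : Γ →ₗ[ℝ] Γ →ₗ[ℝ] Γ
  /-- the anchor -/
  anchor : Γ →ₗ[A] VectorFields A
  /-- the inner product, of any signature -/
  pairing : Γ →ₗ[A] Γ →ₗ[A] A
  pairing_symm : ∀ s t, pairing s t = pairing t s
  pairing_nondegenerate : Function.Bijective pairing
  leibniz_identity : ∀ a b c,
    dorfman a (dorfman b c) = dorfman (dorfman a b) c + dorfman b (dorfman a c)
  anchor_dorfman : ∀ a b, anchor (dorfman a b) = ⁅anchor a, anchor b⁆
  dorfman_smul : ∀ a (f : A) b, dorfman a (f • b) = f • dorfman a b + anchor a f • b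
  dorfman_self : ∀ a x, pairing (dorfman a a) x = (1 / 2 : ℝ) • anchor x (pairing a a)
  anchor_pairing : ∀ a b c,
    anchor a (pairing b c) = pairing (dorfman a b) c + pairing b (dorfman a c)

/-- A linear connection `D` on the vector bundle with module of sections `Γ`. -/
structure LinearConnection where
  /-- the covariant derivative `D_v s` -/
  cov : VectorFields A → Γ → Γ
  cov_add_left : ∀ u v s, cov (u + v) s = cov u s + cov v s
  cov_smul_left : ∀ (f : A) v s, cov (f • v) s = f • cov v s
  cov_add_right : ∀ v s t, cov v (s + t) = cov v s + cov v t
  cov_smul_right : ∀ v (f : A) s, cov v (f • s) = v f • s + f • cov v s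

/-- A (pseudo-)Riemannian metric on the base manifold. -/
structure BaseMetric where
  /-- the metric as a bilinear form on vector fields -/
  form : VectorFields A →ₗ[A] VectorFields A →ₗ[A] A
  form_symm : ∀ u v, form u v = form v u
  form_nondegenerate : Function.Bijective form

variable {A Γ}

/-- The differential `df`, as a linear form on vector fields. -/
def differential (f : A) : VectorFields A →ₗ[A] A where
  toFun v := v f
  map_add' _ _ := rfl
  map_smul' _ _ := rfl

/-- The gradient: `g(grad f, v) = v f`. -/
def BaseMetric.grad (g : BaseMetric A) (f : A) : VectorFields A :=
  (LinearEquiv.ofBijective g.form g.form_nondegenerate).symm (differential f)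

/-- The inverse metric `g⁻¹(df, dh)`. -/
def BaseMetric.cometric (g : BaseMetric A) (f h : A) : A := g.grad f h

namespace LinearConnection

variable (D : LinearConnection A Γ)

/-- The curvature `R(u, v) s = D_u D_v s - D_v D_u s - D_{[u, v]} s`. -/
def curvature (u v : VectorFields A) (s : Γ) : Γ :=
  D.cov u (D.cov v s) - D.cov v (D.cov u s) - D.cov ⁅u, v⁆ s

end LinearConnection

namespace CourantAlgebroid

variable (C : CourantAlgebroid A Γ) (D : LinearConnection A Γ)

/-- `D` preserves the inner product. -/
def IsMetricConnection : Prop :=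
  ∀ v s t, v (C.pairing s t) = C.pairing (D.cov v s) t + C.pairing s (D.cov v t)

/-- The Courant bracket, the skew-symmetrization of the Dorfman bracket. -/
def courantBracket (a b : Γ) : Γ := (1 / 2 : ℝ) • (C.dorfman a b - C.dorfman b a)

/-- The summand of the `E`-torsion before the cyclic sum:
`-½ ⟨D_{ρ a} b - D_{ρ b} a, c⟩ + ⅓ ⟨[a, b]_C, c⟩`. -/
def torsionTerm (a b c : Γ) : A :=
  -((1 / 2 : ℝ) • C.pairing (D.cov (C.anchor a) b - D.cov (C.anchor b) a) c)
    + (1 / 3 : ℝ) • C.pairing (C.courantBracket a b) c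

/-- The (Gualtieri) `E`-torsion `T ∈ Γ(∧³ E*)`. -/
def torsion (a b c : Γ) : A :=
  C.torsionTerm D a b c + C.torsionTerm D b c a + C.torsionTerm D c a b

/-- The basic curvature, paired with a section `c`:
`S(v; a, b, c) = (D_v T)(a, b, c) + ⟨R(v, ρ a) b, c⟩ + ⟨R(v, ρ b) c, a⟩ + ⟨R(v, ρ c) a, b⟩`. -/
def basicCurvature (v : VectorFields A) (a b c : Γ) : A :=
  (v (C.torsion D a b c) - C.torsion D (D.cov v a) b c - C.torsion D a (D.cov v b) c
      - C.torsion D a b (D.cov v c))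
    + (C.pairing (D.curvature v (C.anchor a) b) c + C.pairing (D.curvature v (C.anchor b) c) a
      + C.pairing (D.curvature v (C.anchor c) a) b)

/-- A Cartan Courant algebroid: the basic curvature vanishes. -/
def IsCartan : Prop := ∀ v a b c, C.basicCurvature D v a b c = 0

/-- The `E`-connection on `TM`: `ᴱD_e v = [ρ e, v] + ρ (D_v e)`. -/
def baseConnection (e : Γ) (v : VectorFields A) : VectorFields A :=
  ⁅C.anchor e, v⁆ + C.anchor (D.cov v e)

/-- `ᴱD g = 0`. -/
def PreservesMetric (g : BaseMetric A) : Prop :=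
  ∀ e u v, C.anchor e (g.form u v)
    = g.form (C.baseConnection D e u) v + g.form u (C.baseConnection D e v)

end CourantAlgebroid

end Algebraic

/-! ### Smooth sections as a module over smooth functions -/

section Geometric

variable {n r : ℕ} (M : Type*) [TopologicalSpace M] [ChartedSpace (EuclideanSpace ℝ (Fin n)) M]

/-- `C^∞(M)`. -/
abbrev SmoothFn (n : ℕ) (M : Type*) [TopologicalSpace M]
    [ChartedSpace (EuclideanSpace ℝ (Fin n)) M] := C^∞⟮𝓡 n, M; ℝ⟯

variable {M}
variable (V : M → Type*) [TopologicalSpace (Bundle.TotalSpace (EuclideanSpace ℝ (Fin r)) V)]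
  [∀ x, AddCommGroup (V x)] [∀ x, Module ℝ (V x)] [∀ x, TopologicalSpace (V x)]
  [FiberBundle (EuclideanSpace ℝ (Fin r)) V] [VectorBundle ℝ (EuclideanSpace ℝ (Fin r)) V]

/-- `Γ(E)`, the smooth sections of a vector bundle of rank `r`. -/
abbrev SmoothSec (n r : ℕ) {M : Type*} [TopologicalSpace M]
    [ChartedSpace (EuclideanSpace ℝ (Fin n)) M]
    (V : M → Type*) [TopologicalSpace (Bundle.TotalSpace (EuclideanSpace ℝ (Fin r)) V)]
    [∀ x, AddCommGroup (V x)] [∀ x, Module ℝ (V x)] [∀ x, TopologicalSpace (V x)]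
    [FiberBundle (EuclideanSpace ℝ (Fin r)) V] [VectorBundle ℝ (EuclideanSpace ℝ (Fin r)) V] :=
  Cₛ^∞⟮𝓡 n; EuclideanSpace ℝ (Fin r), V⟯

variable {V}

instance SmoothSec.instFnSMul : SMul (SmoothFn n M) (SmoothSec n r V) :=
  ⟨fun f s => ⟨fun x => f x • s x, f.contMDiff.smul_section s.contMDiff⟩⟩

theorem SmoothSec.fn_smul_apply (f : SmoothFn n M) (s : SmoothSec n r V) (x : M) :
    (f • s) x = f x • s x := rfl

instance SmoothSec.instFnModule : Module (SmoothFn n M) (SmoothSec n r V) where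
  one_smul s := by ext x; exact one_smul ℝ (s x)
  mul_smul f g s := by ext x; exact mul_smul (f x) (g x) (s x)
  smul_zero f := by ext x; exact smul_zero (f x)
  smul_add f s t := by ext x; exact smul_add (f x) (s x) (t x)
  add_smul f g s := by ext x; exact add_smul (f x) (g x) (s x)
  zero_smul s := by ext x; exact zero_smul ℝ (s x)

/-- Restriction of smooth functions to an open subset. -/
def restr (U : TopologicalSpace.Opens M) : SmoothFn n M →ₐ[ℝ] SmoothFn n U where
  toFun f := ⟨fun y => f y, f.contMDiff.comp contMDiff_subtype_val⟩
  map_one' := rfl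
  map_mul' _ _ := rfl
  map_zero' := rfl
  map_add' _ _ := rfl
  commutes' _ := rfl

/-! ### Functions on the graded phase space in Darboux coordinates -/

/-- `ℝ[p₁, …, pₙ] ⊗ Λ(η¹, …, ηʳ)`. -/
abbrev FibreFn (n r : ℕ) := MvPolynomial (Fin n) ℝ ⊗[ℝ] ExteriorAlgebra ℝ (Fin r → ℝ)

/-- The fibre coordinate `p_i`. -/
def FibreFn.p (i : Fin n) : FibreFn n r := MvPolynomial.X i ⊗ₜ 1

/-- The fibre coordinate `ηᵃ`. -/
def FibreFn.eta (a : Fin r) : FibreFn n r := 1 ⊗ₜ ExteriorAlgebra.ι ℝ (Pi.single a 1)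

/-- `∂/∂p_i`. -/
def FibreFn.dp (i : Fin n) : FibreFn n r →ₗ[ℝ] FibreFn n r :=
  LinearMap.rTensor _ (MvPolynomial.pderiv i).toLinearMap

/-- The left derivative `∂/∂ηᵃ`. -/
def FibreFn.dEtaLeft (a : Fin r) : FibreFn n r →ₗ[ℝ] FibreFn n r :=
  LinearMap.lTensor _ (CliffordAlgebra.contractLeft (LinearMap.proj a))

/-- The right derivative `∂/∂ηᵃ`. -/
def FibreFn.dEtaRight (a : Fin r) : FibreFn n r →ₗ[ℝ] FibreFn n r :=
  LinearMap.lTensor _ (CliffordAlgebra.contractRight.flip (LinearMap.proj a))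

/-- Substitution of even elements `P i` for `p_i` and of `∑ c, N a c • ηᶜ` for `ηᵃ`. -/
def FibreFn.subst (P : Fin n → FibreFn n r) (N : Matrix (Fin r) (Fin r) ℝ) :
    FibreFn n r →ₗ[ℝ] FibreFn n r :=
  TensorProduct.lift <|
    (LinearMap.mul ℝ (FibreFn n r)).compl₁₂
      ((MvPolynomial.basisMonomials (Fin n) ℝ).constr ℝ
        fun m => (List.ofFn fun i => P i ^ m i).prod)
      ((Algebra.TensorProduct.includeRight (R := ℝ) (A := MvPolynomial (Fin n) ℝ)).comp
        (ExteriorAlgebra.map (Matrix.toLin' N.transpose))).toLinearMap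

/-- Functions on the part of the phase space `T*[2]E[1]` that lies over an open set `U` with
Darboux coordinates: `C^∞(U)[p₁, …, pₙ] ⊗ Λ(η¹, …, ηʳ)`, with `p_i` of degree 2 and `ηᵃ` of
degree 1. -/
abbrev LocalFn (n r : ℕ) {M : Type*} [TopologicalSpace M]
    [ChartedSpace (EuclideanSpace ℝ (Fin n)) M] (U : TopologicalSpace.Opens M) :=
  SmoothFn n U ⊗[ℝ] FibreFn n r

namespace LocalFn

variable {U : TopologicalSpace.Opens M}

/-- A function of the base coordinates. -/
def base (f : SmoothFn n U) : LocalFn n r U := f ⊗ₜ 1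

/-- The coordinate `p_i`. -/
def p (i : Fin n) : LocalFn n r U := 1 ⊗ₜ FibreFn.p i

/-- The coordinate `ηᵃ`. -/
def eta (a : Fin r) : LocalFn n r U := 1 ⊗ₜ FibreFn.eta a

/-- Restriction to the fibre over a point of `U`. -/
def evalAt (y : U) : LocalFn n r U →ₗ[ℝ] FibreFn n r :=
  TensorProduct.lift
    { toFun := fun f => (f y) • LinearMap.id
      map_add' := fun _ _ => add_smul _ _ _
      map_smul' := fun _ _ => mul_smul _ _ _ }

end LocalFn

/-- Local coordinates `xⁱ` of the base with coordinate vector fields `∂_i`, and a local frame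
`e_a` of `E` with constant inner products `k_ab`, over an open set `U`. The functions, fields and
sections are extended (arbitrarily) from `U` to `M`; every point of `M` lies in such a `U`.
The induced coordinates `(xⁱ, p_i, ηᵃ)` of the phase space are Darboux coordinates. -/
structure DarbouxChart (C : CourantAlgebroid (SmoothFn n M) (SmoothSec n r V)) where
  U : TopologicalSpace.Opens M
  x : Fin n → SmoothFn n M
  field : Fin n → VectorFields (SmoothFn n M)
  /-- the restriction of `field i` to `U` -/
  dx : Fin n → VectorFields (SmoothFn n U)
  dx_restr : ∀ i f, dx i (restr U f) = restr U (field i f)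
  /-- `∂_i xʲ = δ_iʲ` on `U` -/
  field_x : ∀ i j, restr U (field i (x j)) = if i = j then 1 else 0
  /-- `df = ∑ i, ∂_i f dxⁱ` on `U` -/
  field_expand : ∀ (v : VectorFields (SmoothFn n M)) f,
    restr U (v f) = ∑ i, restr U (v (x i)) * restr U (field i f)
  e : Fin r → SmoothSec n r V
  k : Matrix (Fin r) (Fin r) ℝ
  k_unit : IsUnit k.det
  /-- `⟨e_a, e_b⟩ = k_ab` on `U` -/
  pairing_e : ∀ a b, restr U (C.pairing (e a) (e b)) = algebraMap ℝ _ (k a b)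
  /-- the `e_a` span `E` over `U` -/
  pairing_expand : ∀ s t, restr U (C.pairing s t)
    = ∑ a, ∑ b, k⁻¹ a b • (restr U (C.pairing s (e a)) * restr U (C.pairing (e b) t))

namespace DarbouxChart

variable {C : CourantAlgebroid (SmoothFn n M) (SmoothSec n r V)} (c c' : DarbouxChart C)

/-- `∂/∂xⁱ`. -/
def dBase (i : Fin n) : LocalFn n r c.U →ₗ[ℝ] LocalFn n r c.U :=
  LinearMap.rTensor _ (c.dx i).toLinearMap

/-- The graded Poisson bracket, with `{xⁱ, p_j} = δⁱ_j`, `{ηᵃ, ηᵇ} = kᵃᵇ` and all other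
brackets of coordinates zero:
`{F, G} = ∑ (∂F/∂xⁱ ∂G/∂p_i - ∂F/∂p_i ∂G/∂xⁱ) + ∑ kᵃᵇ (F ∂←/∂ηᵃ) (∂→/∂ηᵇ G)`. -/
def poisson (F G : LocalFn n r c.U) : LocalFn n r c.U :=
  ∑ i, (c.dBase i F * LinearMap.lTensor _ (FibreFn.dp i) G
      - LinearMap.lTensor _ (FibreFn.dp i) F * c.dBase i G)
    + ∑ a, ∑ b, c.k⁻¹ a b •
      (LinearMap.lTensor _ (FibreFn.dEtaRight a) F * LinearMap.lTensor _ (FibreFn.dEtaLeft b) G)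

/-- The coordinate change over a point `y`, expressing functions of the coordinates of `c'`
through those of `c`. With `e'_a` the frame of `c'`, the linear function `⟨e'_b, ·⟩ = k'_ba η'ᵃ`
is `⟨e'_b, e_c⟩ ηᶜ`, and
`p'_j = (∂'_j xⁱ) p_i + ½ k'ᵘʷ (∂'_j ⟨e_a, e'_w⟩) ⟨e'_u, e_b⟩ ηᵃ ηᵇ`. -/
def transition (y : M) : FibreFn n r →ₗ[ℝ] FibreFn n r :=
  FibreFn.subst
    (fun j => ∑ i, (c'.field j (c.x i)) y • FibreFn.p i
      + (1 / 2 : ℝ) • ∑ a, ∑ b,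
        (∑ u, ∑ w, c'.k⁻¹ u w * (c'.field j (C.pairing (c.e a) (c'.e w))) y
          * (C.pairing (c'.e u) (c.e b)) y) • (FibreFn.eta a * FibreFn.eta b))
    (fun a d => ∑ b, c'.k⁻¹ a b * (C.pairing (c'.e b) (c.e d)) y)

/-- The constraint `G_a = ρⁱ_a p_i`. -/
def constraint (a : Fin r) : LocalFn n r c.U :=
  ∑ i, LocalFn.base (restr c.U (C.anchor (c.e a) (c.x i))) * LocalFn.p i

/-- `f_abc = ⟨[e_a, e_b], e_c⟩`. -/
def structureFn (a b d : Fin r) : SmoothFn n c.U :=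
  restr c.U (C.pairing (C.dorfman (c.e a) (c.e b)) (c.e d))

/-- The BFV charge `S = ηᵃ G_a + (1/3!) f_abc ηᵃ ηᵇ ηᶜ`. -/
def bfvCharge : LocalFn n r c.U :=
  ∑ a, LocalFn.eta a * c.constraint a
    + (1 / 6 : ℝ) • ∑ a, ∑ b, ∑ d,
      LocalFn.base (c.structureFn a b d) * (LocalFn.eta a * LocalFn.eta b * LocalFn.eta d)

/-- The covariantized momentum `p_i + ½ Γ_abi ηᵃ ηᵇ`, with `Γ_abi = ⟨D_{∂_i} e_a, e_b⟩`. -/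
def covMomentum (D : LinearConnection (SmoothFn n M) (SmoothSec n r V)) (i : Fin n) :
    LocalFn n r c.U :=
  LocalFn.p i + (1 / 2 : ℝ) • ∑ a, ∑ b,
    LocalFn.base (restr c.U (C.pairing (D.cov (c.field i) (c.e a)) (c.e b)))
      * (LocalFn.eta a * LocalFn.eta b)

/-- The BFV Hamiltonian `½ gⁱʲ p∇_i p∇_j + (1/4!) W_abcd ηᵃ ηᵇ ηᶜ ηᵈ` for an `E`-4-form `W`. -/
def bfvHamiltonian (D : LinearConnection (SmoothFn n M) (SmoothSec n r V))
    (g : BaseMetric (SmoothFn n M))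
    (W : SmoothSec n r V [⋀^Fin 4]→ₗ[SmoothFn n M] SmoothFn n M) : LocalFn n r c.U :=
  (1 / 2 : ℝ) • ∑ i, ∑ j, LocalFn.base (restr c.U (g.cometric (c.x i) (c.x j)))
      * (c.covMomentum D i * c.covMomentum D j)
    + (1 / 24 : ℝ) • ∑ a, ∑ b, ∑ d, ∑ h,
      LocalFn.base (restr c.U (W ![c.e a, c.e b, c.e d, c.e h]))
        * (LocalFn.eta a * LocalFn.eta b * LocalFn.eta d * LocalFn.eta h)

end DarbouxChart

/-- A global function on the graded phase space `T*[2]E[1]`: local functions in all Darboux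
charts that agree on overlaps under the change of coordinates. -/
structure PhaseSpaceFn (C : CourantAlgebroid (SmoothFn n M) (SmoothSec n r V)) where
  toLocal : ∀ c : DarbouxChart C, LocalFn n r c.U
  compatible : ∀ (c c' : DarbouxChart C) (y : M) (hy : y ∈ c.U) (hy' : y ∈ c'.U),
    c.transition c' y (LocalFn.evalAt ⟨y, hy'⟩ (toLocal c'))
      = LocalFn.evalAt ⟨y, hy⟩ (toLocal c)

/-- The BFV master equations `{S, S} = 0`, `{S, H} = 0`, `{H, H} = 0`. -/
def BFVEquations {C : CourantAlgebroid (SmoothFn n M) (SmoothSec n r V)}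
    (S H : PhaseSpaceFn C) : Prop :=
  ∀ c : DarbouxChart C,
    c.poisson (S.toLocal c) (S.toLocal c) = 0 ∧
    c.poisson (S.toLocal c) (H.toLocal c) = 0 ∧
    c.poisson (H.toLocal c) (H.toLocal c) = 0

end Geometric

end

/-! In Darboux coordinates each bracket splits by its degree in p and η, and every coefficient is an
identity of Courant algebroid geometry.

The bracket {S, S} has three parts. Its pp part is kᵃᵇ ρⁱ_a ρʲ_b, which vanishes because ρ ∘ ρ* = 0.
Its pηη part says that the anchor is a morphism of brackets. Its η⁴ part is the Leibniz identity
written in a frame. The bracket {H, H} vanishes because the Poisson bracket is antisymmetric on even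
functions.

For {S, H} put Pᵢ = p∇ᵢ. Then {S, Pᵢ} = ∑ ηᵃ A_ij,a P_j plus a term cubic in η. Here A_ij,a = ∂ᵢρʲ_a
- ρʲ(D_{∂ᵢ} e_a) is minus the coefficient of ᴱD, and the cubic term is 1/6 of the basic curvature
S(∂ᵢ; e_a, e_b, e_d) contracted with ηᵃηᵇηᵈ. When the basic curvature vanishes, S acts linearly on
the Pᵢ, and {S, ½ gⁱʲPᵢP_j} = 0 becomes the invariance of the inverse metric under ᴱD.

The local expressions glue because the quadratic shift in p' compensates the non-tensorial
transformation of f_abc in S and of Γ_abi in H.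

The sign bookkeeping is done once in an abstract `DarbouxAlgebra`: `poisson_charge_charge`,
`poisson_charge_hamiltonian` and `poisson_hamiltonian_hamiltonian` reduce the equations to
identities between coefficients. Those identities come from `inverseGram_anchor_anchor`,
`anchorCoeff_bracket`, `structureFn_jacobi`, `cubicSum_basicCurvature` and
`sum_anchorCoeff_mul_dx_cometricCoeff`. Gluing is `pullback_bfvCharge` and
`pullback_bfvHamiltonian`. -/

set_option linter.unusedSectionVars false

/-! ### Sums over products of anticommuting elements -/

section Anticommuting

variable {κ R B : Type*} [Fintype κ] [CommRing R] [Ring B] [Algebra R B]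

/-- `F ↦ ∑ F a ηᵃ`. -/
def linearSum (η : κ → B) : (κ → R) →ₗ[R] B where
  toFun F := ∑ a, F a • η a
  map_add' F G := by simp [add_smul, Finset.sum_add_distrib]
  map_smul' t F := by simp [mul_smul, Finset.smul_sum]

/-- `F ↦ ∑ F a b ηᵃ ηᵇ`. -/
def quadraticSum (η : κ → B) : (κ → κ → R) →ₗ[R] B where
  toFun F := ∑ a, ∑ b, F a b • (η a * η b)
  map_add' F G := by simp [add_smul, Finset.sum_add_distrib]
  map_smul' t F := by simp [mul_smul, Finset.smul_sum]

/-- `F ↦ ∑ F a b c ηᵃ ηᵇ ηᶜ`. -/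
def cubicSum (η : κ → B) : (κ → κ → κ → R) →ₗ[R] B where
  toFun F := ∑ a, ∑ b, ∑ c, F a b c • (η a * η b * η c)
  map_add' F G := by simp [add_smul, Finset.sum_add_distrib]
  map_smul' t F := by simp [mul_smul, Finset.smul_sum]

/-- `F ↦ ∑ F a b c d ηᵃ ηᵇ ηᶜ ηᵈ`. -/
def quarticSum (η : κ → B) : (κ → κ → κ → κ → R) →ₗ[R] B where
  toFun F := ∑ a, ∑ b, ∑ c, ∑ d, F a b c d • (η a * η b * η c * η d)
  map_add' F G := by simp [add_smul, Finset.sum_add_distrib]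
  map_smul' t F := by simp [mul_smul, Finset.smul_sum]

theorem linearSum_mul_linearSum (η : κ → B) (F G : κ → R) :
    linearSum η F * linearSum η G = quadraticSum η (fun a b => F a * G b) := by
  simp only [linearSum, quadraticSum, LinearMap.coe_mk, AddHom.coe_mk, Finset.sum_mul_sum,
    smul_mul_smul_comm]

theorem linearSum_mul_quadraticSum (η : κ → B) (F : κ → R) (G : κ → κ → R) :
    linearSum η F * quadraticSum η G = cubicSum η (fun a b c => F a * G b c) := by
  simp only [linearSum, quadraticSum, cubicSum, LinearMap.coe_mk, AddHom.coe_mk, Finset.sum_mul]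
  simp only [Finset.mul_sum, smul_mul_smul_comm, mul_assoc]

theorem linearSum_mul_cubicSum (η : κ → B) (F : κ → R) (G : κ → κ → κ → R) :
    linearSum η F * cubicSum η G = quarticSum η (fun a b c d => F a * G b c d) := by
  simp only [linearSum, cubicSum, quarticSum, LinearMap.coe_mk, AddHom.coe_mk, Finset.sum_mul]
  simp only [Finset.mul_sum, smul_mul_smul_comm, mul_assoc]

theorem cubicSum_mul_linearSum (η : κ → B) (F : κ → κ → κ → R) (G : κ → R) :
    cubicSum η F * linearSum η G = quarticSum η (fun a b c d => F a b c * G d) := by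
  simp only [linearSum, cubicSum, quarticSum, LinearMap.coe_mk, AddHom.coe_mk, Finset.sum_mul]
  simp only [Finset.mul_sum, smul_mul_smul_comm]

theorem quadraticSum_mul_quadraticSum (η : κ → B) (F G : κ → κ → R) :
    quadraticSum η F * quadraticSum η G = quarticSum η (fun a b c d => F a b * G c d) := by
  simp only [quadraticSum, quarticSum, LinearMap.coe_mk, AddHom.coe_mk, Finset.sum_mul]
  simp only [Finset.mul_sum, smul_mul_smul_comm, mul_assoc]

variable {η : κ → B} (hη : ∀ a b, η a * η b = -(η b * η a))
include hη

/-- This and the following index permutations say that only the alternating part of a coefficient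
array survives. Coefficient identities are therefore needed only after antisymmetrization, and no
array has to be antisymmetrized explicitly. -/
theorem quadraticSum_swap (F : κ → κ → R) :
    quadraticSum η (fun a b => F b a) = -quadraticSum η F := by
  simp only [quadraticSum, LinearMap.coe_mk, AddHom.coe_mk, ← Finset.sum_neg_distrib]
  rw [Finset.sum_comm]
  refine Finset.sum_congr rfl fun a _ => Finset.sum_congr rfl fun b _ => ?_
  rw [hη b a, smul_neg]

theorem cubicSum_swap₁₂ (F : κ → κ → κ → R) :
    cubicSum η (fun a b c => F b a c) = -cubicSum η F := by
  simp only [cubicSum, LinearMap.coe_mk, AddHom.coe_mk, ← Finset.sum_neg_distrib]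
  rw [Finset.sum_comm]
  refine Finset.sum_congr rfl fun a _ => Finset.sum_congr rfl fun b _ =>
    Finset.sum_congr rfl fun c _ => ?_
  rw [hη b a, neg_mul, smul_neg]

theorem cubicSum_swap₂₃ (F : κ → κ → κ → R) :
    cubicSum η (fun a b c => F a c b) = -cubicSum η F := by
  simp only [cubicSum, LinearMap.coe_mk, AddHom.coe_mk, ← Finset.sum_neg_distrib]
  refine Finset.sum_congr rfl fun a _ => ?_
  rw [Finset.sum_comm]
  refine Finset.sum_congr rfl fun b _ => Finset.sum_congr rfl fun c _ => ?_
  rw [mul_assoc, hη c b, mul_neg, smul_neg, mul_assoc]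

theorem cubicSum_rotate (F : κ → κ → κ → R) :
    cubicSum η (fun a b c => F b c a) = cubicSum η F := by
  rw [cubicSum_swap₁₂ hη (fun a b c => F a c b), cubicSum_swap₂₃ hη, neg_neg]

theorem cubicSum_rotate' (F : κ → κ → κ → R) :
    cubicSum η (fun a b c => F c a b) = cubicSum η F := by
  rw [cubicSum_swap₂₃ hη (fun a b c => F b a c), cubicSum_swap₁₂ hη, neg_neg]

theorem quarticSum_swap₁₂ (F : κ → κ → κ → κ → R) :
    quarticSum η (fun a b c d => F b a c d) = -quarticSum η F := by
  simp only [quarticSum, LinearMap.coe_mk, AddHom.coe_mk, ← Finset.sum_neg_distrib]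
  rw [Finset.sum_comm]
  refine Finset.sum_congr rfl fun a _ => Finset.sum_congr rfl fun b _ =>
    Finset.sum_congr rfl fun c _ => Finset.sum_congr rfl fun d _ => ?_
  rw [hη b a, neg_mul, neg_mul, smul_neg]

theorem quarticSum_swap₂₃ (F : κ → κ → κ → κ → R) :
    quarticSum η (fun a b c d => F a c b d) = -quarticSum η F := by
  simp only [quarticSum, LinearMap.coe_mk, AddHom.coe_mk, ← Finset.sum_neg_distrib]
  refine Finset.sum_congr rfl fun a _ => ?_
  rw [Finset.sum_comm]
  refine Finset.sum_congr rfl fun b _ => Finset.sum_congr rfl fun c _ =>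
    Finset.sum_congr rfl fun d _ => ?_
  rw [mul_assoc (η a), hη c b, mul_neg, neg_mul, smul_neg, ← mul_assoc (η a)]

theorem quarticSum_swap₃₄ (F : κ → κ → κ → κ → R) :
    quarticSum η (fun a b c d => F a b d c) = -quarticSum η F := by
  simp only [quarticSum, LinearMap.coe_mk, AddHom.coe_mk, ← Finset.sum_neg_distrib]
  refine Finset.sum_congr rfl fun a _ => Finset.sum_congr rfl fun b _ => ?_
  rw [Finset.sum_comm]
  refine Finset.sum_congr rfl fun c _ => Finset.sum_congr rfl fun d _ => ?_
  rw [mul_assoc (η a * η b), hη d c, mul_neg, smul_neg, mul_assoc (η a * η b)]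

end Anticommuting

/-! ### The graded Poisson algebra of Darboux coordinates -/

/-- An algebra `B` over a ring `R` of functions of `xⁱ`, with the generators `p_i`, `ηᵃ` and the
partial derivatives of a Darboux coordinate system. -/
structure DarbouxAlgebra (ι κ R B : Type*) [DecidableEq ι] [DecidableEq κ] [CommRing R]
    [Algebra ℝ R] [Ring B] [Algebra ℝ B] [Algebra R B] where
  p : ι → B
  η : κ → B
  p_mul : ∀ i X, p i * X = X * p i
  η_mul_η : ∀ a b, η a * η b = -(η b * η a)
  η_mul_η_comm : ∀ a b X, η a * η b * X = X * (η a * η b)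
  d : ι → Derivation ℝ R R
  dx : ι → B →ₗ[ℝ] B
  dx_smul : ∀ i (f : R) X, dx i (f • X) = d i f • X + f • dx i X
  dx_mul : ∀ i X Y, dx i (X * Y) = dx i X * Y + X * dx i Y
  dx_p : ∀ i j, dx i (p j) = 0
  dx_η : ∀ i a, dx i (η a) = 0
  dp : ι → B →ₗ[R] B
  dp_mul : ∀ i X Y, dp i (X * Y) = dp i X * Y + X * dp i Y
  dp_p : ∀ i j, dp i (p j) = if i = j then 1 else 0
  dp_η : ∀ i a, dp i (η a) = 0
  dL : κ → B →ₗ[R] B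
  dL_one : ∀ a, dL a 1 = 0
  dL_p_mul : ∀ a i X, dL a (p i * X) = p i * dL a X
  dL_η_mul : ∀ a b X, dL a (η b * X) = (if a = b then X else 0) - η b * dL a X
  dR : κ → B →ₗ[R] B
  dR_one : ∀ a, dR a 1 = 0
  dR_mul_p : ∀ a i X, dR a (X * p i) = dR a X * p i
  dR_mul_η : ∀ a b X, dR a (X * η b) = (if a = b then X else 0) - dR a X * η b

namespace DarbouxAlgebra

variable {ι κ R B : Type*} [Fintype ι] [Fintype κ] [DecidableEq ι] [DecidableEq κ] [CommRing R]
  [Algebra ℝ R] [Ring B] [Algebra ℝ B] [Algebra R B]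
  (Q : DarbouxAlgebra ι κ R B)

/-- The graded Poisson bracket with `{ηᵃ, ηᵇ} = Kᵃᵇ`. -/
def poisson (K : κ → κ → R) (F G : B) : B :=
  ∑ i, (Q.dx i F * Q.dp i G - Q.dp i F * Q.dx i G)
    + ∑ a, ∑ b, K a b • (Q.dR a F * Q.dL b G)

/-- Central elements along which the left `η`-derivatives satisfy the ungraded Leibniz rule. -/
structure IsEven (z : B) : Prop where
  comm : ∀ X, z * X = X * z
  dL_mul : ∀ b X, Q.dL b (z * X) = Q.dL b z * X + z * Q.dL b X

variable {Q}

theorem IsEven.add {z w : B} (hz : Q.IsEven z) (hw : Q.IsEven w) : Q.IsEven (z + w) where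
  comm X := by rw [add_mul, mul_add, hz.comm, hw.comm]
  dL_mul b X := by rw [add_mul, map_add, hz.dL_mul, hw.dL_mul, map_add]; noncomm_ring

theorem IsEven.smul {z : B} (f : R) (hz : Q.IsEven z) : Q.IsEven (f • z) where
  comm X := by rw [smul_mul_assoc, hz.comm, mul_smul_comm]
  dL_mul b X := by
    rw [smul_mul_assoc, map_smul, hz.dL_mul, map_smul, smul_add, smul_mul_assoc, smul_mul_assoc]

theorem IsEven.zero : Q.IsEven 0 where
  comm X := by simp
  dL_mul b X := by simp

theorem IsEven.sum {α : Type*} (s : Finset α) {z : α → B} (hz : ∀ i, Q.IsEven (z i)) :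
    Q.IsEven (∑ i ∈ s, z i) := by
  classical
  induction s using Finset.induction_on with
  | empty => simpa using IsEven.zero
  | insert a s ha ih => rw [Finset.sum_insert ha]; exact (hz a).add ih

theorem dL_p (a : κ) (i : ι) : Q.dL a (Q.p i) = 0 := by
  simpa [Q.dL_one] using Q.dL_p_mul a i 1

theorem dL_η (a b : κ) : Q.dL a (Q.η b) = if a = b then 1 else 0 := by
  simpa [Q.dL_one] using Q.dL_η_mul a b 1

theorem dR_η (a b : κ) : Q.dR a (Q.η b) = if a = b then 1 else 0 := by
  simpa [Q.dR_one] using Q.dR_mul_η a b 1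

theorem isEven_p (i : ι) : Q.IsEven (Q.p i) where
  comm X := Q.p_mul i X
  dL_mul b X := by rw [Q.dL_p_mul, dL_p, zero_mul, zero_add]

theorem isEven_η_mul_η (a b : κ) : Q.IsEven (Q.η a * Q.η b) where
  comm := Q.η_mul_η_comm a b
  dL_mul c X := by
    rw [mul_assoc, Q.dL_η_mul, Q.dL_η_mul, Q.dL_η_mul, dL_η]
    split_ifs <;> noncomm_ring

theorem isEven_quadraticSum (F : κ → κ → R) : Q.IsEven (quadraticSum Q.η F) :=
  IsEven.sum _ fun a => IsEven.sum _ fun b => (isEven_η_mul_η a b).smul _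

theorem dL_quadraticSum (x : κ) (F : κ → κ → R) :
    Q.dL x (quadraticSum Q.η F) = linearSum Q.η (F x) - linearSum Q.η (fun a => F a x) := by
  simp only [quadraticSum, linearSum, LinearMap.coe_mk, AddHom.coe_mk, map_sum, map_smul,
    Q.dL_η_mul, dL_η, smul_sub, mul_ite, mul_one, mul_zero, Finset.sum_sub_distrib, smul_ite,
    smul_zero, Finset.sum_ite_eq, Finset.mem_univ, if_true]
  congr 1
  rw [Finset.sum_comm]
  simp

theorem dL_cubicSum (x : κ) (F : κ → κ → κ → R) :
    Q.dL x (cubicSum Q.η F) = quadraticSum Q.η (F x) - quadraticSum Q.η (fun a b => F a x b)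
      + quadraticSum Q.η (fun a b => F a b x) := by
  have h (a b c : κ) : Q.dL x (Q.η a * Q.η b * Q.η c) = (if x = a then Q.η b * Q.η c else 0)
      - (if x = b then Q.η a * Q.η c else 0) + (if x = c then Q.η a * Q.η b else 0) := by
    rw [mul_assoc, Q.dL_η_mul, Q.dL_η_mul, dL_η]
    split_ifs <;> noncomm_ring
  simp only [quadraticSum, cubicSum, LinearMap.coe_mk, AddHom.coe_mk, map_sum, map_smul, h,
    smul_sub, smul_add, Finset.sum_sub_distrib, Finset.sum_add_distrib, smul_ite,
    smul_zero, Finset.sum_ite_eq, Finset.mem_univ, if_true]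
  congr 2
  · rw [Finset.sum_eq_single x (by intro b _ hb; simp [hb.symm]) (by simp)]
    simp
  · refine Finset.sum_congr rfl fun a _ => ?_
    rw [Finset.sum_eq_single x (by intro b _ hb; simp [hb.symm]) (by simp)]
    simp

/-- Left and right derivatives of a form of degree k in η differ by (-1)ᵏ⁻¹: they agree in odd
degree and are opposite in even degree, as in `dR_quadraticSum`. -/
theorem dR_cubicSum (x : κ) (F : κ → κ → κ → R) :
    Q.dR x (cubicSum Q.η F) = Q.dL x (cubicSum Q.η F) := by
  simp only [cubicSum, LinearMap.coe_mk, AddHom.coe_mk, map_sum, map_smul]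
  refine Finset.sum_congr rfl fun a _ => Finset.sum_congr rfl fun b _ =>
    Finset.sum_congr rfl fun c _ => ?_
  rw [mul_assoc (Q.η a), Q.dL_η_mul, Q.dL_η_mul, dL_η, ← mul_assoc, Q.dR_mul_η, Q.dR_mul_η, dR_η]
  congr 1
  split_ifs <;> noncomm_ring

theorem dR_quadraticSum (x : κ) (F : κ → κ → R) :
    Q.dR x (quadraticSum Q.η F) = -Q.dL x (quadraticSum Q.η F) := by
  simp only [quadraticSum, LinearMap.coe_mk, AddHom.coe_mk, map_sum, map_smul,
    ← Finset.sum_neg_distrib]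
  refine Finset.sum_congr rfl fun a _ => Finset.sum_congr rfl fun b _ => ?_
  rw [Q.dL_η_mul, dL_η, Q.dR_mul_η, dR_η, ← smul_neg]
  congr 1
  split_ifs <;> noncomm_ring

variable (Q)

theorem dx_quadraticSum (i : ι) (F : κ → κ → R) :
    Q.dx i (quadraticSum Q.η F) = quadraticSum Q.η (fun a b => Q.d i (F a b)) := by
  simp [quadraticSum, Q.dx_smul, Q.dx_mul, Q.dx_η]

theorem dx_cubicSum (i : ι) (F : κ → κ → κ → R) :
    Q.dx i (cubicSum Q.η F) = cubicSum Q.η (fun a b c => Q.d i (F a b c)) := by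
  simp [cubicSum, Q.dx_smul, Q.dx_mul, Q.dx_η]

theorem dp_quadraticSum (i : ι) (F : κ → κ → R) : Q.dp i (quadraticSum Q.η F) = 0 := by
  simp [quadraticSum, Q.dp_mul, Q.dp_η]

theorem dp_cubicSum (i : ι) (F : κ → κ → κ → R) : Q.dp i (cubicSum Q.η F) = 0 := by
  simp [cubicSum, Q.dp_mul, Q.dp_η]

/-- `ηᵃ ρᵢₐ pᵢ + F a b c ηᵃ ηᵇ ηᶜ`. -/
def charge (ρ : κ → ι → R) (F : κ → κ → κ → R) : B :=
  ∑ j, linearSum Q.η (fun a => ρ a j) * Q.p j + cubicSum Q.η F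

/-- `pᵢ + F a b ηᵃ ηᵇ`. -/
def shiftedMomentum (F : κ → κ → R) (i : ι) : B := Q.p i + quadraticSum Q.η F

theorem sum_η_mul_sum (ρ : κ → ι → R) :
    ∑ a, Q.η a * ∑ j, ρ a j • Q.p j = ∑ j, linearSum Q.η (fun a => ρ a j) * Q.p j := by
  simp only [linearSum, LinearMap.coe_mk, AddHom.coe_mk, Finset.sum_mul,
    Finset.mul_sum, mul_smul_comm, smul_mul_assoc]
  exact Finset.sum_comm

variable {Q}

theorem dx_charge (ρ : κ → ι → R) (F : κ → κ → κ → R) (i : ι) :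
    Q.dx i (Q.charge ρ F) = Q.charge (fun a j => Q.d i (ρ a j)) (fun a b c => Q.d i (F a b c)) := by
  simp [charge, dx_cubicSum, Q.dx_mul, Q.dx_p, linearSum, Q.dx_smul, Q.dx_η]

theorem dp_charge (ρ : κ → ι → R) (F : κ → κ → κ → R) (i : ι) :
    Q.dp i (Q.charge ρ F) = linearSum Q.η (fun a => ρ a i) := by
  simp [charge, dp_cubicSum, Q.dp_mul, Q.dp_p, linearSum, Q.dp_η]

theorem dL_charge (ρ : κ → ι → R) (F : κ → κ → κ → R) (x : κ) :
    Q.dL x (Q.charge ρ F) = ∑ j, ρ x j • Q.p j + Q.dL x (cubicSum Q.η F) := by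
  simp only [charge, map_add, map_sum, linearSum, Finset.sum_mul, smul_mul_assoc, map_smul,
    Q.dL_η_mul, dL_p, LinearMap.coe_mk, AddHom.coe_mk]
  simp

theorem dR_charge (ρ : κ → ι → R) (F : κ → κ → κ → R) (x : κ) :
    Q.dR x (Q.charge ρ F) = Q.dL x (Q.charge ρ F) := by
  rw [dL_charge, ← dR_cubicSum]
  simp only [charge, map_add, map_sum, linearSum, Finset.sum_mul, smul_mul_assoc, map_smul,
    Q.dR_mul_p, dR_η, LinearMap.coe_mk, AddHom.coe_mk]
  simp

end DarbouxAlgebra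

/-! ### Coordinate form of {S, S} = 0 -/

section Anticommuting

variable {κ R B : Type*} [Fintype κ] [CommRing R] [Ring B] [Algebra R B]
variable {η : κ → B} (hη : ∀ a b, η a * η b = -(η b * η a))
include hη

theorem linearSum_anticomm (F G : κ → R) :
    linearSum η F * linearSum η G = -(linearSum η G * linearSum η F) := by
  rw [linearSum_mul_linearSum, linearSum_mul_linearSum, ← quadraticSum_swap hη]
  simp only [mul_comm]

theorem cubicSum_linearSum_anticomm (F : κ → κ → κ → R) (G : κ → R) :
    cubicSum η F * linearSum η G = -(linearSum η G * cubicSum η F) := by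
  rw [linearSum_mul_cubicSum, cubicSum_mul_linearSum,
    quarticSum_swap₃₄ hη (fun a b c d => F a b d * G c),
    quarticSum_swap₂₃ hη (fun a b c d => F a c d * G b),
    quarticSum_swap₁₂ hη (fun a b c d => F b c d * G a), neg_neg]
  simp only [mul_comm]

end Anticommuting

namespace DarbouxAlgebra

variable {ι κ R B : Type*} [Fintype ι] [Fintype κ] [DecidableEq ι] [DecidableEq κ] [CommRing R]
  [Algebra ℝ R] [Ring B] [Algebra ℝ B] [Algebra R B]
  {Q : DarbouxAlgebra ι κ R B}

theorem linearSum_mul_charge (v : κ → R) (ρ : κ → ι → R) (F : κ → κ → κ → R) :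
    linearSum Q.η v * Q.charge ρ F
      = ∑ j, quadraticSum Q.η (fun a b => v a * ρ b j) * Q.p j
        + quarticSum Q.η (fun a b c d => v a * F b c d) := by
  simp only [charge, mul_add, Finset.mul_sum, ← mul_assoc, linearSum_mul_linearSum,
    linearSum_mul_cubicSum]

theorem charge_mul_linearSum (v : κ → R) (ρ : κ → ι → R) (F : κ → κ → κ → R) :
    Q.charge ρ F * linearSum Q.η v = -(linearSum Q.η v * Q.charge ρ F) := by
  simp only [charge, mul_add, add_mul, Finset.mul_sum, Finset.sum_mul, mul_assoc, Q.p_mul,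
    cubicSum_linearSum_anticomm Q.η_mul_η, neg_add, ← Finset.sum_neg_distrib]
  congr 1
  refine Finset.sum_congr rfl fun j _ => ?_
  rw [← mul_assoc, linearSum_anticomm Q.η_mul_η, neg_mul, mul_assoc]

/-- The derivative can hit any of the three slots, and antisymmetry makes the three contributions
equal. This is the source of the factors 6 = 2·3 and 9 = 3·3 in the coordinate equations below. -/
theorem dL_cubicSum_of_antisymm {F : κ → κ → κ → R} (h₁₂ : ∀ a b c, F a b c = -F b a c)
    (h₂₃ : ∀ a b c, F a b c = -F a c b) (x : κ) :
    Q.dL x (cubicSum Q.η F) = quadraticSum Q.η ((3 : R) • F x) := by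
  rw [dL_cubicSum, sub_add, ← map_sub, ← map_sub]
  congr 1
  ext a b
  have h1 := h₁₂ a x b
  have h2 := h₁₂ a b x
  simp only [Pi.sub_apply, Pi.smul_apply, smul_eq_mul]
  rw [h₂₃ a b x, h1]
  ring

/-- The equation `{S, S} = 0` from its coordinate form. -/
theorem poisson_charge_charge {K : κ → κ → R} (hK : ∀ a b, K a b = K b a)
    {ρ : κ → ι → R} {F : κ → κ → κ → R} (h₁₂ : ∀ a b c, F a b c = -F b a c)
    (h₂₃ : ∀ a b c, F a b c = -F a c b)
    (hρρ : ∀ i j, ∑ a, ∑ b, K a b * (ρ a i * ρ b j) = 0)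
    (hρ : ∀ a b j, ∑ i, ρ a i * Q.d i (ρ b j) - ∑ i, ρ b i * Q.d i (ρ a j)
      = ∑ g, ∑ h, K g h * (6 * ρ g j * F h a b))
    (hF : quarticSum Q.η (fun a b c d => 2 * ∑ i, ρ a i * Q.d i (F b c d)
      - 9 * ∑ g, ∑ h, K g h * (F g a b * F h c d)) = 0) :
    Q.poisson K (Q.charge ρ F) (Q.charge ρ F) = 0 := by
  set q : κ → B := fun x => quadraticSum Q.η ((3 : R) • F x) with hq
  set G : κ → B := fun x => ∑ j, ρ x j • Q.p j with hG
  have hS (x : κ) : Q.dL x (Q.charge ρ F) = G x + q x := by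
    rw [dL_charge, dL_cubicSum_of_antisymm h₁₂ h₂₃]
  have hqc (x : κ) (X : B) : q x * X = X * q x := (isEven_quadraticSum _).comm X
  -- The part quadratic in p: it is the only place where ρ ∘ ρ* = 0 enters.
  have hGG : ∑ a, ∑ b, K a b • (G a * G b) = 0 := by
    have : ∀ a b, K a b • (G a * G b)
        = ∑ i, ∑ j, (K a b * (ρ a i * ρ b j)) • (Q.p i * Q.p j) := fun a b => by
      simp only [hG, Finset.sum_mul_sum, smul_mul_smul_comm, Finset.smul_sum, smul_smul]
    simp only [this]
    calc _ = ∑ i, ∑ j, (∑ a, ∑ b, K a b * (ρ a i * ρ b j)) • (Q.p i * Q.p j) := by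
          simp only [Finset.sum_smul]
          simp_rw [Finset.sum_comm (s := (Finset.univ : Finset κ)) (t := (Finset.univ : Finset ι))]
      _ = 0 := by simp [hρρ]
  have hGq : ∑ a, ∑ b, K a b • (G a * q b) = ∑ j, quadraticSum Q.η
      (fun c d => ∑ a, ∑ b, K a b * (3 * ρ a j * F b c d)) * Q.p j := by
    have (j : ι) : (fun c d => ∑ a, ∑ b, K a b * (3 * ρ a j * F b c d))
        = ∑ a, ∑ b, (K a b * ρ a j) • ((3 : R) • F b) := by
      ext c d
      simp only [Finset.sum_apply, Pi.smul_apply, smul_eq_mul]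
      refine Finset.sum_congr rfl fun a _ => Finset.sum_congr rfl fun b _ => ?_
      ring
    simp only [this, map_sum, map_smul _ (_ * _), Finset.sum_mul]
    symm
    rw [Finset.sum_comm]
    refine Finset.sum_congr rfl fun a _ => ?_
    rw [Finset.sum_comm]
    refine Finset.sum_congr rfl fun b _ => ?_
    simp only [hG, Finset.sum_mul, Finset.smul_sum]
    refine Finset.sum_congr rfl fun j _ => ?_
    rw [smul_mul_assoc, smul_mul_assoc, smul_smul, ← hqc]
  have hqq : ∑ a, ∑ b, K a b • (q a * q b)
      = quarticSum Q.η (fun c d c' d' => 9 * ∑ a, ∑ b, K a b * (F a c d * F b c' d')) := by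
    have : (fun c d c' d' => 9 * ∑ a, ∑ b, K a b * (F a c d * F b c' d'))
        = ∑ a, ∑ b, K a b • (fun c d c' d' => ((3 : R) • F a) c d * ((3 : R) • F b) c' d') := by
      ext c d c' d'
      simp only [Finset.sum_apply, Pi.smul_apply, smul_eq_mul, Finset.mul_sum]
      refine Finset.sum_congr rfl fun a _ => Finset.sum_congr rfl fun b _ => ?_
      ring
    simp only [this, map_sum, map_smul _ (K _ _), hq, quadraticSum_mul_quadraticSum]
  have hη : ∑ a, ∑ b, K a b • (Q.dR a (Q.charge ρ F) * Q.dL b (Q.charge ρ F))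
      = ∑ j, quadraticSum Q.η (fun c d => ∑ a, ∑ b, K a b * (6 * ρ a j * F b c d)) * Q.p j
        + quarticSum Q.η (fun c d c' d' => 9 * ∑ a, ∑ b, K a b * (F a c d * F b c' d')) := by
    have h2 : ∑ a, ∑ b, K a b • (q a * G b) = ∑ a, ∑ b, K a b • (G a * q b) := by
      rw [Finset.sum_comm]
      refine Finset.sum_congr rfl fun a _ => Finset.sum_congr rfl fun b _ => ?_
      rw [hK, hqc]
    simp only [dR_charge, hS, add_mul, mul_add, smul_add, Finset.sum_add_distrib]
    rw [hGG, h2, hqq, zero_add, ← add_assoc, hGq, ← Finset.sum_add_distrib]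
    congr 1
    refine Finset.sum_congr rfl fun j _ => ?_
    rw [← add_mul, ← map_add]
    congr 2
    ext c d
    simp only [Pi.add_apply, ← Finset.sum_add_distrib]
    refine Finset.sum_congr rfl fun a _ => Finset.sum_congr rfl fun b _ => ?_
    ring
  -- The factor 2 arises because ∂S/∂p and ∂S/∂x are odd in η and anticommute, so both halves of the
  -- canonical bracket contribute equally.
  have hx : ∑ i, (Q.dx i (Q.charge ρ F) * Q.dp i (Q.charge ρ F)
        - Q.dp i (Q.charge ρ F) * Q.dx i (Q.charge ρ F))
      = -(∑ j, quadraticSum Q.η (fun a b => 2 * ∑ i, ρ a i * Q.d i (ρ b j)) * Q.p j)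
        - quarticSum Q.η (fun a b c d => 2 * ∑ i, ρ a i * Q.d i (F b c d)) := by
    have h1 (j : ι) : (fun a b => 2 * ∑ i, ρ a i * Q.d i (ρ b j))
        = ∑ i, (2 : R) • fun a b => ρ a i * Q.d i (ρ b j) := by
      ext a b
      simp [Finset.mul_sum]
    have h2 : (fun a b c d => 2 * ∑ i, ρ a i * Q.d i (F b c d))
        = ∑ i, (2 : R) • fun a b c d => ρ a i * Q.d i (F b c d) := by
      ext a b
      simp [Finset.mul_sum]
    simp only [dx_charge, dp_charge, charge_mul_linearSum, linearSum_mul_charge, h1, h2, map_sum,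
      Finset.sum_mul]
    rw [Finset.sum_comm, ← Finset.sum_neg_distrib, ← Finset.sum_sub_distrib]
    refine Finset.sum_congr rfl fun i _ => ?_
    simp only [two_smul, map_add, add_mul, Finset.sum_add_distrib]
    abel
  rw [poisson, hx, hη]
  -- Antisymmetrization in a, b turns 2 ρ_a(ρ_b) into the commutator ρ_a(ρ_b) - ρ_b(ρ_a), to which
  -- `hρ` applies.
  have hquad (j : ι) : quadraticSum Q.η (fun a b => 2 * ∑ i, ρ a i * Q.d i (ρ b j))
      = quadraticSum Q.η (fun c d => ∑ a, ∑ b, K a b * (6 * ρ a j * F b c d)) := by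
    simp only [← hρ]
    have := quadraticSum_swap Q.η_mul_η fun a b => ∑ i, ρ a i * Q.d i (ρ b j)
    calc _ = quadraticSum Q.η (fun a b => ∑ i, ρ a i * Q.d i (ρ b j))
          - quadraticSum Q.η (fun a b => ∑ i, ρ b i * Q.d i (ρ a j)) := by
          rw [this, sub_neg_eq_add, ← map_add]
          congr 1
          ext a b
          simp [two_mul]
      _ = _ := by rw [← map_sub]; rfl
  have hF' := hF
  rw [show (fun a b c d => 2 * ∑ i, ρ a i * Q.d i (F b c d)
      - 9 * ∑ g, ∑ h, K g h * (F g a b * F h c d))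
      = (fun a b c d => 2 * ∑ i, ρ a i * Q.d i (F b c d))
        - (fun a b c d => 9 * ∑ g, ∑ h, K g h * (F g a b * F h c d)) from rfl, map_sub,
      sub_eq_zero] at hF'
  simp only [hquad, hF']
  abel

end DarbouxAlgebra

/-! ### Coordinate form of {H, H} = 0 and {S, H} = 0 -/

namespace DarbouxAlgebra

variable {ι κ R B : Type*} [Fintype ι] [Fintype κ] [DecidableEq ι] [DecidableEq κ] [CommRing R]
  [Algebra ℝ R] [Ring B] [Algebra ℝ B] [Algebra R B]
  {Q : DarbouxAlgebra ι κ R B}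

theorem isEven_shiftedMomentum (F : κ → κ → R) (i : ι) : Q.IsEven (Q.shiftedMomentum F i) :=
  (isEven_p i).add (isEven_quadraticSum F)

theorem dx_shiftedMomentum (F : κ → κ → R) (i j : ι) :
    Q.dx j (Q.shiftedMomentum F i) = quadraticSum Q.η (fun a b => Q.d j (F a b)) := by
  rw [shiftedMomentum, map_add, Q.dx_p, dx_quadraticSum, zero_add]

theorem dp_shiftedMomentum (F : κ → κ → R) (i j : ι) :
    Q.dp j (Q.shiftedMomentum F i) = if j = i then 1 else 0 := by
  rw [shiftedMomentum, map_add, Q.dp_p, dp_quadraticSum, add_zero]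

theorem dL_shiftedMomentum {F : κ → κ → R} (hF : ∀ a b, F a b = -F b a) (i : ι) (x : κ) :
    Q.dL x (Q.shiftedMomentum F i) = linearSum Q.η ((2 : R) • F x) := by
  rw [shiftedMomentum, map_add, dL_p, dL_quadraticSum, zero_add, ← map_sub]
  congr 1
  ext a
  simp only [Pi.sub_apply, Pi.smul_apply, smul_eq_mul, hF a x]
  ring

theorem dR_mul_quadraticSum (x : κ) (X : B) (F : κ → κ → R) :
    Q.dR x (X * quadraticSum Q.η F)
      = Q.dR x X * quadraticSum Q.η F + X * Q.dR x (quadraticSum Q.η F) := by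
  simp only [quadraticSum, LinearMap.coe_mk, AddHom.coe_mk, map_sum, map_smul, Finset.mul_sum,
    mul_smul_comm, ← Finset.sum_add_distrib, ← smul_add]
  refine Finset.sum_congr rfl fun a _ => Finset.sum_congr rfl fun b _ => ?_
  rw [← mul_assoc, Q.dR_mul_η, Q.dR_mul_η, Q.dR_mul_η, dR_η]
  congr 1
  split_ifs <;> noncomm_ring

theorem dR_mul_shiftedMomentum (x : κ) (X : B) (F : κ → κ → R) (i : ι) :
    Q.dR x (X * Q.shiftedMomentum F i)
      = Q.dR x X * Q.shiftedMomentum F i - X * Q.dL x (Q.shiftedMomentum F i) := by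
  rw [shiftedMomentum, mul_add, map_add, Q.dR_mul_p, dR_mul_quadraticSum, dR_quadraticSum,
    map_add, dL_p]
  noncomm_ring

variable (Q) in
/-- `½ gⁱʲ Pᵢ Pⱼ`. -/
def hamiltonian (h : R) (g : ι → ι → R) (F : ι → κ → κ → R) : B :=
  h • ∑ i, ∑ j, g i j • (Q.shiftedMomentum (F i) i * Q.shiftedMomentum (F j) j)

/-- The equation `{H, H} = 0`. -/
theorem poisson_hamiltonian_hamiltonian {K : κ → κ → R} (hK : ∀ a b, K a b = K b a) (h : R)
    (g : ι → ι → R) {F : ι → κ → κ → R} (hF : ∀ i a b, F i a b = -F i b a) :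
    Q.poisson K (Q.hamiltonian h g F) (Q.hamiltonian h g F) = 0 := by
  set P : ι → B := fun i => Q.shiftedMomentum (F i) i with hP
  have hPe (i : ι) : Q.IsEven (P i) := isEven_shiftedMomentum _ _
  set H := Q.hamiltonian h g F with hH
  -- ∂H/∂p is a linear combination of the Pᵢ, hence central, so the canonical part of {H, H} cancels
  -- termwise.
  have hdp (i : ι) : Q.IsEven (Q.dp i H) := by
    simp only [hH, hamiltonian, map_smul, map_sum, Q.dp_mul, dp_shiftedMomentum]
    refine IsEven.smul _ <| IsEven.sum _ fun j => IsEven.sum _ fun k => IsEven.smul _ ?_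
    refine IsEven.add ?_ ?_
    · split_ifs
      · simpa using hPe k
      · simpa using IsEven.zero
    · split_ifs
      · simpa using hPe j
      · simpa using IsEven.zero
  have hL (a : κ) : Q.dL a H
      = h • ∑ i, ∑ j, g i j • (linearSum Q.η ((2 : R) • F i a) * P j
        + linearSum Q.η ((2 : R) • F j a) * P i) := by
    rw [hH, hamiltonian, map_smul]
    congr 1
    simp only [map_sum]
    refine Finset.sum_congr rfl fun i _ => Finset.sum_congr rfl fun j _ => ?_
    change Q.dL a (_ • (P i * P j)) = _
    rw [map_smul, (hPe i).dL_mul, dL_shiftedMomentum (hF _), dL_shiftedMomentum (hF _), (hPe i).comm]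
  have hR (a : κ) : Q.dR a H = -Q.dL a H := by
    simp only [hH, hamiltonian, map_smul, map_sum, ← smul_neg, ← Finset.sum_neg_distrib]
    congr 1
    refine Finset.sum_congr rfl fun i _ => Finset.sum_congr rfl fun j _ => ?_
    rw [dR_mul_shiftedMomentum, (isEven_shiftedMomentum _ _).dL_mul]
    have := dR_mul_shiftedMomentum (Q := Q) a 1 (F i) i
    rw [Q.dR_one, one_mul, one_mul, zero_mul, zero_sub] at this
    rw [this]
    congr 1
    noncomm_ring
  have hl (u v : κ → R) (i : ι) : linearSum Q.η u * P i * linearSum Q.η v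
      = -(linearSum Q.η v * (linearSum Q.η u * P i)) := by
    rw [mul_assoc, (hPe i).comm, ← mul_assoc, linearSum_anticomm Q.η_mul_η, neg_mul, mul_assoc]
  have hlin (a : κ) (v : κ → R) :
      Q.dL a H * linearSum Q.η v = -(linearSum Q.η v * Q.dL a H) := by
    simp only [hL, smul_mul_assoc, mul_smul_comm, Finset.sum_mul, Finset.mul_sum, ← smul_neg,
      ← Finset.sum_neg_distrib, add_mul, mul_add, neg_add, hl]
  -- The ∂H/∂ηᵃ are odd and anticommute, while K is symmetric. The η part of {H, H} is therefore
  -- equal to its own negative.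
  have hLL (a b : κ) : Q.dL a H * Q.dL b H = -(Q.dL b H * Q.dL a H) := by
    conv_lhs => rw [hL b]
    conv_rhs => rw [hL b]
    simp only [smul_mul_assoc, mul_smul_comm, Finset.sum_mul, Finset.mul_sum, ← smul_neg,
      ← Finset.sum_neg_distrib, add_mul, mul_add, neg_add]
    congr 1
    refine Finset.sum_congr rfl fun i _ => Finset.sum_congr rfl fun j _ => ?_
    rw [← mul_assoc, hlin, ← mul_assoc, hlin, mul_assoc _ (P j), (hPe j).comm, mul_assoc _ (P i),
      (hPe i).comm]
    noncomm_ring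
  have hη : ∑ a, ∑ b, K a b • (Q.dL a H * Q.dL b H)
      = -∑ a, ∑ b, K a b • (Q.dL a H * Q.dL b H) := by
    conv_lhs => rw [Finset.sum_comm]
    simp only [← Finset.sum_neg_distrib]
    refine Finset.sum_congr rfl fun a _ => Finset.sum_congr rfl fun b _ => ?_
    rw [hK, hLL, smul_neg]
  have hη' : ∑ a, ∑ b, K a b • (Q.dL a H * Q.dL b H) = 0 := by
    have h2 := eq_neg_iff_add_eq_zero.mp hη
    rw [← two_smul ℝ] at h2
    simpa using h2
  simp only [poisson, hR, neg_mul, smul_neg, Finset.sum_neg_distrib, hη', (hdp _).comm, sub_self,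
    Finset.sum_const_zero, neg_zero, add_zero]

/-- No sign appears in the Leibniz rule since the first factor `z` is even, hence central. -/
theorem poisson_mul_right {K : κ → κ → R} (S : B) {z w : B} (hz : Q.IsEven z) :
    Q.poisson K S (z * w) = Q.poisson K S z * w + z * Q.poisson K S w := by
  simp only [poisson, Q.dp_mul, Q.dx_mul, hz.dL_mul, add_mul, Finset.sum_mul, mul_add,
    Finset.mul_sum, sub_mul, mul_sub, smul_add, Finset.sum_add_distrib, Finset.sum_sub_distrib,
    smul_mul_assoc, mul_smul_comm]
  simp only [← mul_assoc, hz.comm]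
  simp only [mul_assoc]
  abel

/-- The first term is {S, f}: a function of x alone brackets only with the p-dependence of S. -/
theorem poisson_smul_right {K : κ → κ → R} (S : B) (f : R) (w : B) :
    Q.poisson K S (f • w) = -(∑ i, Q.d i f • Q.dp i S) * w + f • Q.poisson K S w := by
  simp only [poisson, map_smul, Q.dx_smul, mul_add, Finset.sum_sub_distrib, Finset.sum_add_distrib,
    smul_add, smul_sub, Finset.smul_sum, neg_mul, Finset.sum_mul, mul_smul_comm, smul_mul_assoc,
    smul_comm f]
  abel

theorem poisson_add_right {K : κ → κ → R} (S z w : B) :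
    Q.poisson K S (z + w) = Q.poisson K S z + Q.poisson K S w := by
  simp only [poisson, map_add, mul_add, smul_add, Finset.sum_add_distrib, Finset.sum_sub_distrib]
  abel

theorem poisson_sum_right {K : κ → κ → R} (S : B) {α : Type*} (s : Finset α) (z : α → B) :
    Q.poisson K S (∑ i ∈ s, z i) = ∑ i ∈ s, Q.poisson K S (z i) := by
  classical
  induction s using Finset.induction_on with
  | empty => simp [poisson]
  | insert a s ha ih => rw [Finset.sum_insert ha, Finset.sum_insert ha, poisson_add_right, ih]

variable (Q) in
/-- The coefficients `∂ᵢ ρⱼₐ - Γᵢᵇₐ ρⱼ_b` of the covariant derivative of the anchor. -/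
def anchorDerivative (K : κ → κ → R) (ρ : κ → ι → R) (F : ι → κ → κ → R) (i j : ι) (a : κ) : R :=
  Q.d i (ρ a j) + ∑ g, ∑ h, K g h * (ρ g j * (2 * F i h a))

/-- The part of {S, Pᵢ} linear in p dictates the coefficients `anchorDerivative`. Completing each
p_j to P_j then costs a term cubic in η, and `hΦ` says exactly that the cubic terms balance. For the
actual structure functions this is where the basic curvature appears. -/
theorem poisson_charge_shiftedMomentum {K : κ → κ → R}
    {ρ : κ → ι → R} {Φ : κ → κ → κ → R} (h₁₂ : ∀ a b c, Φ a b c = -Φ b a c)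
    (h₂₃ : ∀ a b c, Φ a b c = -Φ a c b)
    {F : ι → κ → κ → R} (hF : ∀ i a b, F i a b = -F i b a) (i : ι)
    (hΦ : cubicSum Q.η (fun a b c => Q.d i (Φ a b c) - ∑ j, ρ a j * Q.d j (F i b c)
      + 6 * ∑ g, ∑ h, K g h * (Φ g a b * F i h c)
      - ∑ j, Q.anchorDerivative K ρ F i j a * F j b c) = 0) :
    Q.poisson K (Q.charge ρ Φ) (Q.shiftedMomentum (F i) i)
      = ∑ j, linearSum Q.η (Q.anchorDerivative K ρ F i j) * Q.shiftedMomentum (F j) j := by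
  have hS (x : κ) : Q.dR x (Q.charge ρ Φ)
      = ∑ j, ρ x j • Q.p j + quadraticSum Q.η ((3 : R) • Φ x) := by
    rw [dR_charge, dL_charge, dL_cubicSum_of_antisymm h₁₂ h₂₃]
  have hp (j : ι) : linearSum Q.η (Q.anchorDerivative K ρ F i j)
      = linearSum Q.η (fun a => Q.d i (ρ a j))
        + ∑ g, ∑ h, K g h • ρ g j • linearSum Q.η ((2 : R) • F i h) := by
    simp only [← map_smul, ← map_sum, ← map_add]
    congr 1
    ext a
    simp [anchorDerivative, Finset.sum_apply]
  have h3 : cubicSum Q.η (fun a b c => Q.d i (Φ a b c))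
      - ∑ j, cubicSum Q.η (fun a b c => ρ a j * Q.d j (F i b c))
      + ∑ g, ∑ h, K g h • cubicSum Q.η
          (fun a b c => ((3 : R) • Φ g) a b * ((2 : R) • F i h) c)
      = ∑ j, cubicSum Q.η (fun a b c => Q.anchorDerivative K ρ F i j a * F j b c) := by
    rw [← sub_eq_zero, ← hΦ]
    simp only [← map_smul, ← map_sum, ← map_add, ← map_sub]
    congr 1
    ext a b c
    simp only [Pi.sub_apply, Pi.add_apply, Finset.sum_apply, Pi.smul_apply, smul_eq_mul,
      Finset.mul_sum]
    congr 2
    refine Finset.sum_congr rfl fun g _ => Finset.sum_congr rfl fun h _ => ?_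
    ring
  have hql (g h : κ) : quadraticSum Q.η ((3 : R) • Φ g) * linearSum Q.η ((2 : R) • F i h)
      = cubicSum Q.η (fun a b c => ((3 : R) • Φ g) a b * ((2 : R) • F i h) c) := by
    rw [(isEven_quadraticSum (Q := Q) _).comm, linearSum_mul_quadraticSum,
      ← cubicSum_rotate Q.η_mul_η (fun a b c => ((3 : R) • Φ g) a b * ((2 : R) • F i h) c)]
    congr 1
    ext a b c
    exact mul_comm _ _
  have hx : ∑ j, (Q.dx j (Q.charge ρ Φ) * Q.dp j (Q.shiftedMomentum (F i) i)
        - Q.dp j (Q.charge ρ Φ) * Q.dx j (Q.shiftedMomentum (F i) i))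
      = Q.charge (fun a j => Q.d i (ρ a j)) (fun a b c => Q.d i (Φ a b c))
        - ∑ j, cubicSum Q.η (fun a b c => ρ a j * Q.d j (F i b c)) := by
    simp only [dp_shiftedMomentum, dx_shiftedMomentum, dx_charge, dp_charge,
      linearSum_mul_quadraticSum, Finset.sum_sub_distrib, mul_ite, mul_one, mul_zero,
      Finset.sum_ite_eq', Finset.mem_univ, if_true]
  have hη : ∑ a, ∑ b, K a b •
        (Q.dR a (Q.charge ρ Φ) * Q.dL b (Q.shiftedMomentum (F i) i))
      = ∑ j, (∑ g, ∑ h, K g h • ρ g j • linearSum Q.η ((2 : R) • F i h)) * Q.p j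
        + ∑ g, ∑ h, K g h • cubicSum Q.η
          (fun a b c => ((3 : R) • Φ g) a b * ((2 : R) • F i h) c) := by
    simp only [hS, dL_shiftedMomentum (hF i), add_mul, smul_add, Finset.sum_add_distrib, hql]
    congr 1
    simp only [Finset.sum_mul, Finset.smul_sum, smul_mul_assoc, Q.p_mul]
    symm
    rw [Finset.sum_comm]
    refine Finset.sum_congr rfl fun a _ => ?_
    rw [Finset.sum_comm]
  rw [poisson, hx, hη, charge]
  simp only [shiftedMomentum, mul_add, linearSum_mul_quadraticSum, Finset.sum_add_distrib]
  rw [← h3]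
  simp only [hp, add_mul, Finset.sum_add_distrib]
  abel

/-- The equation `{S, H} = 0` from its coordinate form. -/
theorem poisson_charge_hamiltonian {K : κ → κ → R}
    {ρ : κ → ι → R} {Φ : κ → κ → κ → R} (h₁₂ : ∀ a b c, Φ a b c = -Φ b a c)
    (h₂₃ : ∀ a b c, Φ a b c = -Φ a c b)
    {F : ι → κ → κ → R} (hF : ∀ i a b, F i a b = -F i b a)
    (hΦ : ∀ i, cubicSum Q.η (fun a b c => Q.d i (Φ a b c) - ∑ j, ρ a j * Q.d j (F i b c)
      + 6 * ∑ g, ∑ h, K g h * (Φ g a b * F i h c)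
      - ∑ j, Q.anchorDerivative K ρ F i j a * F j b c) = 0)
    {h : R} (hh : ∀ i, Q.d i h = 0) {g : ι → ι → R} (hgs : ∀ i j, g i j = g j i)
    (hg : ∀ a i j, ∑ k, ρ a k * Q.d k (g i j)
      = ∑ l, g i l * Q.anchorDerivative K ρ F l j a
        + ∑ l, g j l * Q.anchorDerivative K ρ F l i a) :
    Q.poisson K (Q.charge ρ Φ) (Q.hamiltonian h g F) = 0 := by
  set P : ι → B := fun i => Q.shiftedMomentum (F i) i with hP
  have hPe (i : ι) : Q.IsEven (P i) := isEven_shiftedMomentum _ _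
  set L : ι → ι → B := fun i j => linearSum Q.η (Q.anchorDerivative K ρ F i j) with hL
  have hSP (i : ι) : Q.poisson K (Q.charge ρ Φ) (P i) = ∑ k, L i k * P k :=
    poisson_charge_shiftedMomentum h₁₂ h₂₃ hF i (hΦ i)
  have hgL (i j : ι) : ∑ k, Q.d k (g i j) • Q.dp k (Q.charge ρ Φ)
      = ∑ l, g i l • L l j + ∑ l, g j l • L l i := by
    simp only [dp_charge, hL, ← map_smul, ← map_sum, ← map_add]
    congr 1
    ext a
    simp only [Finset.sum_apply, Pi.smul_apply, Pi.add_apply, smul_eq_mul, ← hg]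
    simp only [mul_comm]
  have hsum : Q.poisson K (Q.charge ρ Φ) (∑ i, ∑ j, g i j • (P i * P j)) = 0 := by
    simp only [poisson_sum_right, poisson_smul_right, poisson_mul_right _ (hPe _), hgL, hSP]
    simp only [neg_mul, add_mul, Finset.sum_mul, Finset.mul_sum, smul_add, Finset.smul_sum,
      Finset.sum_add_distrib, Finset.sum_neg_distrib, smul_mul_assoc, neg_add]
    -- The derivative of gⁱʲ produces two sums, and the Leibniz rule on PᵢP_j produces two more.
    -- Relabelling indices matches them in pairs; the second pair also uses the symmetry of gⁱʲ.
    have e1 : ∑ i, ∑ j, ∑ l, g i l • (L l j * (P i * P j))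
        = ∑ i, ∑ j, ∑ k, g i j • (P i * (L j k * P k)) := by
      refine Finset.sum_congr rfl fun i _ => ?_
      rw [Finset.sum_comm]
      refine Finset.sum_congr rfl fun j _ => Finset.sum_congr rfl fun k _ => ?_
      rw [← mul_assoc, ← mul_assoc, (hPe i).comm]
    have e2 : ∑ i, ∑ j, ∑ l, g j l • (L l i * (P i * P j))
        = ∑ i, ∑ j, ∑ k, g i j • (L i k * P k * P j) := by
      rw [Finset.sum_comm]
      have : ∑ i, ∑ j, ∑ k, g i j • (L i k * P k * P j)
          = ∑ j, ∑ k, ∑ i, g i j • (L i k * P k * P j) := by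
        rw [Finset.sum_comm]
        exact Finset.sum_congr rfl fun j _ => Finset.sum_comm
      rw [this]
      refine Finset.sum_congr rfl fun i _ => Finset.sum_congr rfl fun j _ =>
        Finset.sum_congr rfl fun k _ => ?_
      rw [hgs, mul_assoc]
    rw [e1, e2]
    abel
  rw [hamiltonian, poisson_smul_right, hsum]
  simp [hh]

end DarbouxAlgebra

/-! ### Functions on a Darboux chart form a Darboux algebra -/

noncomputable section

namespace TensorProduct

variable {𝕜 A B : Type*} [CommRing 𝕜] [Ring A] [Algebra 𝕜 A] [Ring B] [Algebra 𝕜 B]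

theorem lTensor_leibniz {f : B →ₗ[𝕜] B} (hf : ∀ x y, f (x * y) = f x * y + x * f y)
    (X Y : A ⊗[𝕜] B) :
    f.lTensor A (X * Y) = f.lTensor A X * Y + X * f.lTensor A Y := by
  induction X with
  | zero => simp
  | add X X' h h' => simp only [add_mul, map_add, h, h']; abel
  | tmul a b =>
    induction Y with
    | zero => simp
    | add Y Y' h h' => simp only [mul_add, map_add, h, h']; abel
    | tmul a' b' => simp [hf, tmul_add]

theorem rTensor_leibniz {f : A →ₗ[𝕜] A} (hf : ∀ x y, f (x * y) = f x * y + x * f y)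
    (X Y : A ⊗[𝕜] B) :
    f.rTensor B (X * Y) = f.rTensor B X * Y + X * f.rTensor B Y := by
  induction X with
  | zero => simp
  | add X X' h h' => simp only [add_mul, map_add, h, h']; abel
  | tmul a b =>
    induction Y with
    | zero => simp
    | add Y Y' h h' => simp only [mul_add, map_add, h, h']; abel
    | tmul a' b' => simp [hf, add_tmul]

theorem one_tmul_comm {b : B} (hb : ∀ x, b * x = x * b) (X : A ⊗[𝕜] B) :
    (1 ⊗ₜ b) * X = X * (1 ⊗ₜ b) := by
  induction X with
  | zero => simp
  | add X X' h h' => rw [mul_add, add_mul, h, h']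
  | tmul a' b' => simp [hb]

theorem tmul_one_comm {a : A} (ha : ∀ x, a * x = x * a) (X : A ⊗[𝕜] B) :
    (a ⊗ₜ 1) * X = X * (a ⊗ₜ 1) := by
  induction X with
  | zero => simp
  | add X X' h h' => rw [mul_add, add_mul, h, h']
  | tmul a' b' => simp [ha]

theorem lTensor_one_tmul_mul {f : B →ₗ[𝕜] B} {b : B} {t : 𝕜} {s : B}
    (hf : ∀ x, f (b * x) = t • x + s * f x) (X : A ⊗[𝕜] B) :
    f.lTensor A ((1 ⊗ₜ b) * X) = t • X + (1 ⊗ₜ s) * f.lTensor A X := by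
  induction X with
  | zero => simp
  | add X X' h h' => simp only [mul_add, map_add, h, h', smul_add]; abel
  | tmul a' b' => simp [hf, tmul_add]

theorem lTensor_mul_one_tmul {f : B →ₗ[𝕜] B} {b : B} {t : 𝕜} {s : B}
    (hf : ∀ x, f (x * b) = t • x + f x * s) (X : A ⊗[𝕜] B) :
    f.lTensor A (X * (1 ⊗ₜ b)) = t • X + f.lTensor A X * (1 ⊗ₜ s) := by
  induction X with
  | zero => simp
  | add X X' h h' => simp only [add_mul, map_add, h, h', smul_add]; abel
  | tmul a' b' => simp [hf, tmul_add]

theorem lTensor_tmul_one_mul (f : B →ₗ[𝕜] B) (a : A) (X : A ⊗[𝕜] B) :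
    f.lTensor A ((a ⊗ₜ 1) * X) = (a ⊗ₜ 1) * f.lTensor A X := by
  induction X with
  | zero => simp
  | add X X' h h' => simp only [mul_add, map_add, h, h']
  | tmul a' b' => simp

theorem lTensor_mul_tmul_one (f : B →ₗ[𝕜] B) (a : A) (X : A ⊗[𝕜] B) :
    f.lTensor A (X * (a ⊗ₜ 1)) = f.lTensor A X * (a ⊗ₜ 1) := by
  induction X with
  | zero => simp
  | add X X' h h' => simp only [add_mul, map_add, h, h']
  | tmul a' b' => simp

end TensorProduct

namespace ExteriorAlgebra

variable {𝕜 E : Type*} [CommRing 𝕜] [AddCommGroup E] [Module 𝕜 E]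

theorem ι_mul_ι_anticomm (v w : E) : ι 𝕜 v * ι 𝕜 w = -(ι 𝕜 w * ι 𝕜 v) :=
  eq_neg_of_add_eq_zero_left (ι_add_mul_swap v w)

theorem ι_mul_ι_comm (v w : E) (X : ExteriorAlgebra 𝕜 E) :
    ι 𝕜 v * ι 𝕜 w * X = X * (ι 𝕜 v * ι 𝕜 w) := by
  induction X using ExteriorAlgebra.induction with
  | algebraMap t => rw [Algebra.commutes]
  | ι u =>
    rw [mul_assoc, ι_mul_ι_anticomm w u, mul_neg, ← mul_assoc, ι_mul_ι_anticomm v u]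
    noncomm_ring
  | mul X Y h h' => rw [← mul_assoc, h, mul_assoc, h', mul_assoc]
  | add X Y h h' => rw [mul_add, add_mul, h, h']

end ExteriorAlgebra

namespace FibreFn

variable {n r : ℕ}

theorem p_mul (i : Fin n) (X : FibreFn n r) : p i * X = X * p i :=
  TensorProduct.tmul_one_comm (fun x => mul_comm _ x) X

theorem eta_mul_eta (a b : Fin r) : (eta a * eta b : FibreFn n r) = -(eta b * eta a) := by
  simp only [eta, Algebra.TensorProduct.tmul_mul_tmul]
  rw [ExteriorAlgebra.ι_mul_ι_anticomm, TensorProduct.tmul_neg]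

theorem eta_mul_eta_comm (a b : Fin r) (X : FibreFn n r) :
    eta a * eta b * X = X * (eta a * eta b) := by
  simp only [eta, Algebra.TensorProduct.tmul_mul_tmul, one_mul]
  exact TensorProduct.one_tmul_comm (ExteriorAlgebra.ι_mul_ι_comm _ _) X

theorem dp_mul (i : Fin n) (X Y : FibreFn n r) : dp i (X * Y) = dp i X * Y + X * dp i Y := by
  refine TensorProduct.rTensor_leibniz (fun x y => ?_) X Y
  simp only [Derivation.coeFn_coe, Derivation.leibniz, smul_eq_mul]
  ring

theorem dp_p (i j : Fin n) : dp i (p j : FibreFn n r) = if i = j then 1 else 0 := by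
  simp only [dp, p, LinearMap.rTensor_tmul, Derivation.coeFn_coe,
    MvPolynomial.pderiv_X, Pi.single_apply]
  split_ifs with h h' h' <;> simp_all [Algebra.TensorProduct.one_def]

theorem dp_eta (i : Fin n) (a : Fin r) : dp i (eta a) = 0 := by
  simp [dp, eta]

theorem dEtaLeft_one (a : Fin r) : dEtaLeft a (1 : FibreFn n r) = 0 := by
  simp [dEtaLeft, Algebra.TensorProduct.one_def]

theorem dEtaRight_one (a : Fin r) : dEtaRight a (1 : FibreFn n r) = 0 := by
  simp [dEtaRight, Algebra.TensorProduct.one_def]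

theorem dEtaLeft_p_mul (a : Fin r) (i : Fin n) (X : FibreFn n r) :
    dEtaLeft a (p i * X) = p i * dEtaLeft a X :=
  TensorProduct.lTensor_tmul_one_mul _ _ X

theorem dEtaRight_mul_p (a : Fin r) (i : Fin n) (X : FibreFn n r) :
    dEtaRight a (X * p i) = dEtaRight a X * p i :=
  TensorProduct.lTensor_mul_tmul_one _ _ X

theorem dEtaLeft_eta_mul (a b : Fin r) (X : FibreFn n r) :
    dEtaLeft a (eta b * X) = (if a = b then (1 : ℝ) else 0) • X + -eta b * dEtaLeft a X := by
  have := TensorProduct.lTensor_one_tmul_mul (A := MvPolynomial (Fin n) ℝ)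
    (f := CliffordAlgebra.contractLeft (Q := (0 : QuadraticForm ℝ (Fin r → ℝ)))
      (LinearMap.proj a)) (b := ExteriorAlgebra.ι ℝ (Pi.single b 1))
    (t := if a = b then (1 : ℝ) else 0) (s := -ExteriorAlgebra.ι ℝ (Pi.single b 1)) (fun x => by
      refine (CliffordAlgebra.contractLeft_ι_mul _ _ _).trans ?_
      simp [Pi.single_apply, sub_eq_add_neg]) X
  rwa [TensorProduct.tmul_neg] at this

theorem dEtaRight_mul_eta (a b : Fin r) (X : FibreFn n r) :
    dEtaRight a (X * eta b) = (if a = b then (1 : ℝ) else 0) • X + dEtaRight a X * -eta b := by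
  have := TensorProduct.lTensor_mul_one_tmul (A := MvPolynomial (Fin n) ℝ)
    (f := (CliffordAlgebra.contractRight (Q := (0 : QuadraticForm ℝ (Fin r → ℝ)))).flip
      (LinearMap.proj a)) (b := ExteriorAlgebra.ι ℝ (Pi.single b 1))
    (t := if a = b then (1 : ℝ) else 0) (s := -ExteriorAlgebra.ι ℝ (Pi.single b 1)) (fun x => by
      refine (CliffordAlgebra.contractRight_mul_ι _ _ _).trans ?_
      simp [Pi.single_apply, sub_eq_add_neg]) X
  rwa [TensorProduct.tmul_neg] at this

end FibreFn

namespace LocalFn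

variable {n r : ℕ} {M : Type*} [TopologicalSpace M] [ChartedSpace (EuclideanSpace ℝ (Fin n)) M]
  {U : TopologicalSpace.Opens M}

theorem base_mul (f : SmoothFn n U) (X : LocalFn n r U) : base f * X = f • X := by
  rw [← algebraMap_smul (LocalFn n r U) f X, smul_eq_mul]
  rfl

theorem ite_real_smul (q : Prop) [Decidable q] (X : LocalFn n r U) :
    (if q then (1 : ℝ) else 0) • X = if q then X else 0 := by
  split_ifs <;> simp

end LocalFn

variable {n r : ℕ} {M : Type*} [TopologicalSpace M] [ChartedSpace (EuclideanSpace ℝ (Fin n)) M]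
  {V : M → Type*} [TopologicalSpace (Bundle.TotalSpace (EuclideanSpace ℝ (Fin r)) V)]
  [∀ x, AddCommGroup (V x)] [∀ x, Module ℝ (V x)] [∀ x, TopologicalSpace (V x)]
  [FiberBundle (EuclideanSpace ℝ (Fin r)) V] [VectorBundle ℝ (EuclideanSpace ℝ (Fin r)) V]
  {C : CourantAlgebroid (SmoothFn n M) (SmoothSec n r V)}

/-- The generators and partial derivatives of a Darboux chart. -/
def DarbouxChart.darbouxAlgebra (c : DarbouxChart C) :
    DarbouxAlgebra (Fin n) (Fin r) (SmoothFn n c.U) (LocalFn n r c.U) where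
  p := LocalFn.p
  η := LocalFn.eta
  p_mul i X := TensorProduct.one_tmul_comm (FibreFn.p_mul i) X
  η_mul_η a b := by
    simp only [LocalFn.eta, Algebra.TensorProduct.tmul_mul_tmul]
    rw [FibreFn.eta_mul_eta, TensorProduct.tmul_neg]
  η_mul_η_comm a b X := by
    simp only [LocalFn.eta, Algebra.TensorProduct.tmul_mul_tmul, one_mul]
    exact TensorProduct.one_tmul_comm (FibreFn.eta_mul_eta_comm a b) X
  d := c.dx
  dx := c.dBase
  dx_smul i f X := by
    have h := TensorProduct.rTensor_leibniz (B := FibreFn n r) (f := (c.dx i).toLinearMap)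
      (fun x y => by
        simp only [Derivation.coeFn_coe, Derivation.leibniz, smul_eq_mul]
        ring) (LocalFn.base f) X
    have h' : (c.dx i).toLinearMap.rTensor (FibreFn n r) (LocalFn.base f)
        = LocalFn.base (c.dx i f) := rfl
    rwa [h', LocalFn.base_mul, LocalFn.base_mul, LocalFn.base_mul] at h
  dx_mul i X Y := TensorProduct.rTensor_leibniz (fun x y => by
    simp only [Derivation.coeFn_coe, Derivation.leibniz, smul_eq_mul]
    ring) X Y
  dx_p i j := by simp [DarbouxChart.dBase, LocalFn.p]
  dx_η i a := by simp [DarbouxChart.dBase, LocalFn.eta]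
  dp i := (FibreFn.dp i).baseChange (SmoothFn n c.U)
  dp_mul i X Y := TensorProduct.lTensor_leibniz (FibreFn.dp_mul i) X Y
  dp_p i j := by
    simp only [LocalFn.p, LinearMap.baseChange_tmul, FibreFn.dp_p]
    split_ifs <;> simp [Algebra.TensorProduct.one_def]
  dp_η i a := by simp [LocalFn.eta, FibreFn.dp_eta]
  dL a := (FibreFn.dEtaLeft a).baseChange (SmoothFn n c.U)
  dL_one a := by
    rw [Algebra.TensorProduct.one_def, LinearMap.baseChange_tmul, FibreFn.dEtaLeft_one,
      TensorProduct.tmul_zero]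
  dL_p_mul a i X := by
    have := TensorProduct.lTensor_one_tmul_mul (A := SmoothFn n c.U) (t := 0)
      (fun x => by rw [FibreFn.dEtaLeft_p_mul a i x, zero_smul, zero_add]) X
    rwa [zero_smul, zero_add] at this
  dL_η_mul a b X := by
    have := TensorProduct.lTensor_one_tmul_mul (A := SmoothFn n c.U)
      (FibreFn.dEtaLeft_eta_mul (n := n) a b) X
    rwa [LocalFn.ite_real_smul, TensorProduct.tmul_neg, neg_mul, ← sub_eq_add_neg] at this
  dR a := (FibreFn.dEtaRight a).baseChange (SmoothFn n c.U)
  dR_one a := by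
    rw [Algebra.TensorProduct.one_def, LinearMap.baseChange_tmul, FibreFn.dEtaRight_one,
      TensorProduct.tmul_zero]
  dR_mul_p a i X := by
    have := TensorProduct.lTensor_mul_one_tmul (A := SmoothFn n c.U) (t := 0)
      (fun x => by rw [FibreFn.dEtaRight_mul_p a i x, zero_smul, zero_add]) X
    rwa [zero_smul, zero_add] at this
  dR_mul_η a b X := by
    have := TensorProduct.lTensor_mul_one_tmul (A := SmoothFn n c.U)
      (FibreFn.dEtaRight_mul_eta (n := n) a b) X
    rwa [LocalFn.ite_real_smul, TensorProduct.tmul_neg, mul_neg, ← sub_eq_add_neg] at this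

theorem DarbouxChart.poisson_eq (c : DarbouxChart C) (F G : LocalFn n r c.U) :
    c.poisson F G
      = c.darbouxAlgebra.poisson (fun a b => algebraMap ℝ (SmoothFn n c.U) (c.k⁻¹ a b)) F G := by
  simp only [DarbouxAlgebra.poisson, algebraMap_smul]
  rfl

end

/-! ### Charge and Hamiltonian in the abstract form -/

noncomputable section

variable {n r : ℕ} {M : Type*} [TopologicalSpace M] [ChartedSpace (EuclideanSpace ℝ (Fin n)) M]
  {V : M → Type*} [TopologicalSpace (Bundle.TotalSpace (EuclideanSpace ℝ (Fin r)) V)]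
  [∀ x, AddCommGroup (V x)] [∀ x, Module ℝ (V x)] [∀ x, TopologicalSpace (V x)]
  [FiberBundle (EuclideanSpace ℝ (Fin r)) V] [VectorBundle ℝ (EuclideanSpace ℝ (Fin r)) V]
  {C : CourantAlgebroid (SmoothFn n M) (SmoothSec n r V)}

namespace DarbouxChart

variable (c : DarbouxChart C)

/-- `ρⁱ_a` on `U`. -/
def anchorCoeff (a : Fin r) (i : Fin n) : SmoothFn n c.U := restr c.U (C.anchor (c.e a) (c.x i))

/-- `Γ_abi` on `U`. -/
def connectionCoeff (D : LinearConnection (SmoothFn n M) (SmoothSec n r V)) (i : Fin n)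
    (a b : Fin r) : SmoothFn n c.U := restr c.U (C.pairing (D.cov (c.field i) (c.e a)) (c.e b))

/-- `kᵃᵇ` as a constant function. -/
def inverseGram (a b : Fin r) : SmoothFn n c.U := algebraMap ℝ _ (c.k⁻¹ a b)

/-- `gⁱʲ` on `U`. -/
def cometricCoeff (g : BaseMetric (SmoothFn n M)) (i j : Fin n) : SmoothFn n c.U :=
  restr c.U (g.cometric (c.x i) (c.x j))

theorem bfvCharge_eq : c.bfvCharge
    = c.darbouxAlgebra.charge c.anchorCoeff (fun a b d => (1 / 6 : ℝ) • c.structureFn a b d) := by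
  have h1 : ∑ a, LocalFn.eta a * c.constraint a = ∑ j, linearSum c.darbouxAlgebra.η
      (fun a => c.anchorCoeff a j) * c.darbouxAlgebra.p j := by
    simp only [constraint, LocalFn.base_mul]
    exact c.darbouxAlgebra.sum_η_mul_sum c.anchorCoeff
  rw [bfvCharge, h1, DarbouxAlgebra.charge]
  congr 1
  simp only [cubicSum, LinearMap.coe_mk, AddHom.coe_mk, Finset.smul_sum, LocalFn.base_mul,
    smul_assoc]
  rfl

theorem covMomentum_eq (D : LinearConnection (SmoothFn n M) (SmoothSec n r V)) (i : Fin n) :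
    c.covMomentum D i = c.darbouxAlgebra.shiftedMomentum
      (fun a b => (1 / 2 : ℝ) • c.connectionCoeff D i a b) i := by
  rw [covMomentum, DarbouxAlgebra.shiftedMomentum]
  congr 1
  simp only [quadraticSum, LinearMap.coe_mk, AddHom.coe_mk, Finset.smul_sum, LocalFn.base_mul,
    smul_assoc]
  rfl

theorem bfvHamiltonian_eq (D : LinearConnection (SmoothFn n M) (SmoothSec n r V))
    (g : BaseMetric (SmoothFn n M)) :
    c.bfvHamiltonian D g 0 = c.darbouxAlgebra.hamiltonian (algebraMap ℝ _ (1 / 2))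
      (c.cometricCoeff g) (fun i a b => (1 / 2 : ℝ) • c.connectionCoeff D i a b) := by
  have h0 (v) : (0 : SmoothSec n r V [⋀^Fin 4]→ₗ[SmoothFn n M] SmoothFn n M) v = 0 := rfl
  have hb : (LocalFn.base 0 : LocalFn n r c.U) = 0 := TensorProduct.zero_tmul _ _
  have h1 (X : LocalFn n r c.U) : 0 * X = 0 := zero_mul X
  have h2 : (1 / 24 : ℝ) • (0 : LocalFn n r c.U) = 0 := smul_zero _
  rw [bfvHamiltonian, DarbouxAlgebra.hamiltonian, algebraMap_smul]
  simp only [h0, map_zero, hb, h1, Finset.sum_const_zero, h2, add_zero,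
    covMomentum_eq, LocalFn.base_mul]
  rfl

end DarbouxChart

end

/-! ### Courant algebroid axioms in a local frame -/

noncomputable section

namespace CourantAlgebroid

section Algebraic

variable {A Γ : Type*} [CommRing A] [Algebra ℝ A] [AddCommGroup Γ] [Module ℝ Γ] [Module A Γ]
  (C : CourantAlgebroid A Γ)

theorem pairing_ext {s t : Γ} (h : ∀ x, C.pairing s x = C.pairing t x) : s = t :=
  C.pairing_nondegenerate.injective (LinearMap.ext h)

/-- Polarization of `dorfman_self`. -/
theorem pairing_dorfman_add_swap (a b x : Γ) :
    C.pairing (C.dorfman a b) x + C.pairing (C.dorfman b a) x = C.anchor x (C.pairing a b) := by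
  have h := C.dorfman_self (a + b) x
  simp only [map_add, LinearMap.add_apply, C.dorfman_self, C.pairing_symm b a, smul_add] at h
  linear_combination (exp := 1) h + (by rw [← add_smul]; norm_num :
    (1 / 2 : ℝ) • C.anchor x (C.pairing a b) + (1 / 2 : ℝ) • C.anchor x (C.pairing a b)
      = C.anchor x (C.pairing a b))

/-- The section dual to `x ↦ ρ(x) f`. -/
def gradient (f : A) : Γ :=
  (LinearEquiv.ofBijective C.pairing C.pairing_nondegenerate).symm ((differential f).comp C.anchor)

theorem pairing_gradient (f : A) (x : Γ) : C.pairing (C.gradient f) x = C.anchor x f :=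
  LinearMap.congr_fun ((LinearEquiv.ofBijective C.pairing
    C.pairing_nondegenerate).apply_symm_apply ((differential f).comp C.anchor)) x

/-- The gradient of ⟨a, b⟩ is [a, b] + [b, a], and the anchor sends the two summands to opposite
commutators. -/
theorem anchor_gradient_pairing (a b : Γ) : C.anchor (C.gradient (C.pairing a b)) = 0 := by
  have h : C.gradient (C.pairing a b) = C.dorfman a b + C.dorfman b a := C.pairing_ext fun x => by
    rw [pairing_gradient, map_add, LinearMap.add_apply, C.pairing_dorfman_add_swap]
  rw [h, map_add, C.anchor_dorfman, C.anchor_dorfman, ← lie_skew, neg_add_cancel]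

/-- The previous lemma concerns gradients of inner products only. Rescaling `a` by `f` makes the
gradient of an arbitrary `f` appear, at the price of the factor ⟨a, b⟩. -/
theorem pairing_mul_anchor_gradient (f h : A) (a b : Γ) :
    C.pairing a b * C.anchor (C.gradient f) h = 0 := by
  have h1 : C.gradient (C.pairing (f • a) b)
      = f • C.gradient (C.pairing a b) + C.pairing a b • C.gradient f := C.pairing_ext fun x => by
    simp only [pairing_gradient, map_add, map_smul, LinearMap.add_apply, LinearMap.smul_apply,
      smul_eq_mul, Derivation.leibniz]
  have h2 := congrArg C.anchor h1
  rw [anchor_gradient_pairing, map_add, map_smul, map_smul, anchor_gradient_pairing, smul_zero,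
    zero_add] at h2
  simpa using (congrArg (fun v : VectorFields A => v h) h2).symm

theorem pairing_dorfman_right (a b x : Γ) : C.pairing (C.dorfman a b) x
    = C.anchor a (C.pairing b x) - C.pairing b (C.dorfman a x) := by
  rw [C.anchor_pairing]; ring

theorem pairing_dorfman_left (a b x : Γ) : C.pairing (C.dorfman a b) x
    = C.anchor x (C.pairing a b) - C.pairing (C.dorfman b a) x := by
  rw [← C.pairing_dorfman_add_swap]; ring

/-- Invariance of the pairing and the rule for the symmetric part of the bracket trade every nested
bracket for a derivative of some ⟨[·, ·], ·⟩ and a pairing of two single brackets. Both can be read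
off in a frame. -/
theorem jacobi_pairing (a b c d : Γ) :
    C.anchor a (C.pairing (C.dorfman b c) d) + C.anchor c (C.pairing (C.dorfman a b) d)
      - C.anchor d (C.pairing (C.dorfman a b) c) - C.anchor b (C.pairing (C.dorfman a c) d)
    = C.pairing (C.dorfman b c) (C.dorfman a d) + C.pairing (C.dorfman a b) (C.dorfman c d)
      - C.pairing (C.dorfman a c) (C.dorfman b d) := by
  have h := congrArg (fun s => C.pairing s d) (C.leibniz_identity a b c)
  simp only [map_add, LinearMap.add_apply] at h
  rw [C.pairing_dorfman_right a (C.dorfman b c), C.pairing_dorfman_left (C.dorfman a b),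
    C.pairing_dorfman_right c (C.dorfman a b), C.pairing_dorfman_right b (C.dorfman a c)] at h
  linear_combination h

end Algebraic

end CourantAlgebroid

variable {n r : ℕ} {M : Type*} [TopologicalSpace M] [ChartedSpace (EuclideanSpace ℝ (Fin n)) M]
  {V : M → Type*} [TopologicalSpace (Bundle.TotalSpace (EuclideanSpace ℝ (Fin r)) V)]
  [∀ x, AddCommGroup (V x)] [∀ x, Module ℝ (V x)] [∀ x, TopologicalSpace (V x)]
  [FiberBundle (EuclideanSpace ℝ (Fin r)) V] [VectorBundle ℝ (EuclideanSpace ℝ (Fin r)) V]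
  {C : CourantAlgebroid (SmoothFn n M) (SmoothSec n r V)}

namespace DarbouxChart

variable (c : DarbouxChart C)

theorem restr_field (v : VectorFields (SmoothFn n M)) (f : SmoothFn n M) :
    restr c.U (v f) = ∑ i, restr c.U (v (c.x i)) * c.dx i (restr c.U f) := by
  rw [c.field_expand v f]
  exact Finset.sum_congr rfl fun i _ => by rw [c.dx_restr]

theorem restr_anchor (a : Fin r) (f : SmoothFn n M) :
    restr c.U (C.anchor (c.e a) f) = ∑ i, c.anchorCoeff a i * c.dx i (restr c.U f) :=
  c.restr_field _ _

theorem restr_field_pairing_frame (v : VectorFields (SmoothFn n M)) (a b : Fin r) :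
    restr c.U (v (C.pairing (c.e a) (c.e b))) = 0 := by
  rw [c.restr_field v, c.pairing_e]
  refine Finset.sum_eq_zero fun i _ => ?_
  rw [Derivation.map_algebraMap, mul_zero]

theorem restr_pairing (s t : SmoothSec n r V) : restr c.U (C.pairing s t)
    = ∑ a, ∑ b, c.inverseGram a b
      * (restr c.U (C.pairing s (c.e a)) * restr c.U (C.pairing (c.e b) t)) := by
  rw [c.pairing_expand s t]
  exact Finset.sum_congr rfl fun a _ => Finset.sum_congr rfl fun b _ => Algebra.smul_def _ _

/-- ρ(s) f is the pairing of s with the gradient of f, so the expansion of the pairing applies. -/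
theorem restr_anchor_section (s : SmoothSec n r V) (f : SmoothFn n M) :
    restr c.U (C.anchor s f) = ∑ a, ∑ b, c.inverseGram a b
      * (restr c.U (C.pairing s (c.e a)) * restr c.U (C.anchor (c.e b) f)) := by
  rw [← C.pairing_gradient, C.pairing_symm, c.restr_pairing]
  simp only [C.pairing_symm _ (C.gradient f), C.pairing_gradient]

/-- A point of U is required: over the empty set `pairing_e` is an equation in the zero ring and
puts no constraint on `k`. -/
theorem k_symm (y : c.U) : c.k.transpose = c.k := by
  ext a b
  have h1 := congrArg (fun f : SmoothFn n c.U => f y) (c.pairing_e a b)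
  have h2 := congrArg (fun f : SmoothFn n c.U => f y) (c.pairing_e b a)
  rw [C.pairing_symm] at h2
  exact h2.symm.trans h1

theorem k_inv_symm (y : c.U) (a b : Fin r) : c.k⁻¹ a b = c.k⁻¹ b a := by
  have h := Matrix.transpose_nonsing_inv c.k
  rw [c.k_symm y] at h
  exact congrFun (congrFun h b) a

theorem inverseGram_symm (a b : Fin r) : c.inverseGram a b = c.inverseGram b a := by
  ext y
  rw [inverseGram, inverseGram, c.k_inv_symm y]

/-- This is ρ ∘ ρ* = 0 in coordinates. On U the factor ⟨a, b⟩ of `pairing_mul_anchor_gradient`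
becomes a constant k_ab for frame sections; a diagonal entry of k k⁻¹ = 1 combines these constants
into 1. -/
theorem inverseGram_anchor_anchor (f h : SmoothFn n M) : ∑ a, ∑ b, c.inverseGram a b
    * (restr c.U (C.anchor (c.e a) f) * restr c.U (C.anchor (c.e b) h)) = 0 := by
  have h1 : restr c.U (C.anchor (C.gradient f) h) = ∑ a, ∑ b, c.inverseGram a b
      * (restr c.U (C.anchor (c.e a) f) * restr c.U (C.anchor (c.e b) h)) := by
    rw [c.restr_anchor_section]
    simp only [C.pairing_gradient]
  rcases isEmpty_or_nonempty (Fin r) with hr | ⟨⟨a⟩⟩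
  · simp
  · rw [← h1]
    have h2 (b : Fin r) : c.k a b • restr c.U (C.anchor (C.gradient f) h) = 0 := by
      rw [Algebra.smul_def, ← c.pairing_e, ← map_mul, C.pairing_mul_anchor_gradient, map_zero]
    calc _ = (∑ b, c.k a b * c.k⁻¹ b a) • restr c.U (C.anchor (C.gradient f) h) := by
          rw [← Matrix.mul_apply, Matrix.mul_nonsing_inv _ c.k_unit, Matrix.one_apply_eq, one_smul]
      _ = 0 := by simp [Finset.sum_smul, mul_comm, mul_smul, h2]

theorem structureFn_swap₁₂ (a b d : Fin r) : c.structureFn a b d = -c.structureFn b a d := by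
  rw [structureFn, C.pairing_dorfman_left, map_sub, c.restr_field_pairing_frame, zero_sub,
    structureFn]

theorem structureFn_swap₂₃ (a b d : Fin r) : c.structureFn a b d = -c.structureFn a d b := by
  rw [structureFn, C.pairing_dorfman_right, map_sub, c.restr_field_pairing_frame, zero_sub,
    structureFn, C.pairing_symm]

theorem structureFn_rotate (a b d : Fin r) : c.structureFn a b d = c.structureFn d a b := by
  rw [c.structureFn_swap₂₃, c.structureFn_swap₁₂, neg_neg]

theorem connectionCoeff_swap {D : LinearConnection (SmoothFn n M) (SmoothSec n r V)}
    (hD : C.IsMetricConnection D) (i : Fin n) (a b : Fin r) :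
    c.connectionCoeff D i a b = -c.connectionCoeff D i b a := by
  have h := congrArg (restr c.U) (hD (c.field i) (c.e a) (c.e b))
  rw [c.restr_field_pairing_frame, map_add, C.pairing_symm (c.e a)] at h
  exact eq_neg_of_add_eq_zero_left h.symm

theorem anchorCoeff_bracket (a b : Fin r) (j : Fin n) :
    ∑ i, c.anchorCoeff a i * c.dx i (c.anchorCoeff b j)
      - ∑ i, c.anchorCoeff b i * c.dx i (c.anchorCoeff a j)
    = ∑ g, ∑ h, c.inverseGram g h * (c.anchorCoeff g j * c.structureFn h a b) := by
  have h := congrArg (fun v : VectorFields _ => restr c.U (v (c.x j)))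
    (C.anchor_dorfman (c.e a) (c.e b))
  simp only [Derivation.commutator_apply, map_sub] at h
  rw [c.restr_anchor a (C.anchor (c.e b) _), c.restr_anchor b (C.anchor (c.e a) _),
    c.restr_anchor_section, Finset.sum_comm] at h
  rw [anchorCoeff, anchorCoeff, ← h]
  refine Finset.sum_congr rfl fun g _ => Finset.sum_congr rfl fun k _ => ?_
  rw [c.inverseGram_symm, ← c.structureFn_rotate, anchorCoeff, structureFn]
  ring

theorem structureFn_jacobi (a b d e : Fin r) :
    ∑ i, c.anchorCoeff a i * c.dx i (c.structureFn b d e)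
      + ∑ i, c.anchorCoeff d i * c.dx i (c.structureFn a b e)
      - ∑ i, c.anchorCoeff e i * c.dx i (c.structureFn a b d)
      - ∑ i, c.anchorCoeff b i * c.dx i (c.structureFn a d e)
    = ∑ g, ∑ h, c.inverseGram g h * (c.structureFn g b d * c.structureFn h a e)
      + ∑ g, ∑ h, c.inverseGram g h * (c.structureFn g a b * c.structureFn h d e)
      - ∑ g, ∑ h, c.inverseGram g h * (c.structureFn g a d * c.structureFn h b e) := by
  have h := congrArg (restr c.U) (C.jacobi_pairing (c.e a) (c.e b) (c.e d) (c.e e))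
  simp only [map_add, map_sub, c.restr_anchor] at h
  simp only [← c.structureFn_rotate]
  rw [c.restr_pairing (C.dorfman _ _) (C.dorfman _ _), c.restr_pairing (C.dorfman _ _)
    (C.dorfman (c.e d) (c.e e)), c.restr_pairing (C.dorfman _ _)
    (C.dorfman (c.e b) (c.e e))] at h
  simp only [C.pairing_symm (c.e _) (C.dorfman _ _)] at h
  exact h

end DarbouxChart

end

/-! ### Torsion, basic curvature and invariance of the metric -/

noncomputable section

section Anticommuting

variable {κ R B : Type*} [Fintype κ] [CommRing R] [Ring B] [Algebra R B]
variable {η : κ → B} (hη : ∀ a b, η a * η b = -(η b * η a))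
include hη

/-- Antisymmetrization of the vanishing basic curvature. -/
theorem cubicSum_eq_zero_of_basicCurvature {df dA tf tA tB ρΓ dρΓ : κ → κ → κ → R}
    (h : ∀ a b c, df a b c - dA a b c + dA b a c - dA c a b
      - (tf b c a - tA b c a + tA c b a - tB b c a)
      - (tf c a b - tA c a b + tA a c b - tB c a b)
      - (tf a b c - tA a b c + tA b a c - tB a b c)
      + (dA a b c - tA a b c - ρΓ a b c + tA a c b - dρΓ a b c)
      + (dA b c a - tA b c a - ρΓ b c a + tA b a c - dρΓ b c a)
      + (dA c a b - tA c a b - ρΓ c a b + tA c b a - dρΓ c a b) = 0) :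
    cubicSum η (df - (3 : R) • tf + (3 : R) • tB - (3 : R) • ρΓ - (3 : R) • dρΓ) = 0 := by
  -- `Y` is one cyclic block, torsion correction minus curvature. A cubic sum is invariant under
  -- rotation of indices, so the three blocks count three times `Y`. The terms `dA` then cancel, and
  -- so do the terms `tA` inside `Y`.
  set Y : κ → κ → κ → R := fun a b c => (tf a b c - tA a b c + tA b a c - tB a b c)
    - (dA a b c - tA a b c - ρΓ a b c + tA a c b - dρΓ a b c) with hY
  have h1 : df - dA + (fun a b c => dA b a c) - (fun a b c => dA c a b)
      - (fun a b c => Y b c a) - (fun a b c => Y c a b) - Y = 0 := by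
    ext a b c
    simp only [hY, Pi.sub_apply, Pi.add_apply, Pi.zero_apply]
    linear_combination h a b c
  have h2 : Y = tf - tA + (fun a b c => tA b a c) - tB - dA + tA + ρΓ
      - (fun a b c => tA a c b) + dρΓ := by
    ext a b c
    simp only [hY, Pi.sub_apply, Pi.add_apply]
    ring
  have h3 := congrArg (cubicSum η) h1
  have h4 := congrArg (cubicSum η) h2
  simp only [map_sub, map_add, cubicSum_swap₁₂ hη dA, cubicSum_swap₁₂ hη tA,
    cubicSum_swap₂₃ hη tA, cubicSum_rotate hη Y, cubicSum_rotate' hη Y, cubicSum_rotate' hη dA,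
    map_zero] at h3 h4
  simp only [map_sub, map_add, map_smul]
  rw [h4] at h3
  rw [← h3]
  module

end Anticommuting

namespace CourantAlgebroid

section Algebraic

variable {A Γ : Type*} [CommRing A] [Algebra ℝ A] [AddCommGroup Γ] [Module ℝ Γ] [Module A Γ]
  (C : CourantAlgebroid A Γ) {D : LinearConnection A Γ}

theorem pairing_courantBracket (a b c : Γ) : C.pairing (C.courantBracket a b) c
    = algebraMap ℝ A (1 / 2) * (C.pairing (C.dorfman a b) c - C.pairing (C.dorfman b a) c) := by
  have h : C.courantBracket a b + C.courantBracket a b = C.dorfman a b - C.dorfman b a := by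
    rw [courantBracket, ← add_smul]; norm_num
  have h' := congrArg (fun s => C.pairing s c) h
  simp only [map_add, map_sub, LinearMap.add_apply, LinearMap.sub_apply] at h'
  have h2 : algebraMap ℝ A (1 / 2) * 2 = 1 := by
    rw [← map_ofNat (algebraMap ℝ A) 2, ← map_mul]; norm_num
  linear_combination algebraMap ℝ A (1 / 2) * h' - C.pairing (C.courantBracket a b) c * h2

/-- Up to terms in D, ⟨[x, y], z⟩ is skew in x, y by polarization and in y, z by invariance of the
pairing; metricity of D expresses the correction terms. The six bracket terms of the cyclic sum,
each of weight ⅓·½ = 1/6, therefore reduce to a single one. -/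
theorem torsion_eq (hD : C.IsMetricConnection D) (a b c : Γ) : C.torsion D a b c
    = C.pairing (C.dorfman a b) c - C.pairing (D.cov (C.anchor a) b) c
      + C.pairing (D.cov (C.anchor b) a) c - C.pairing (D.cov (C.anchor c) a) b := by
  have h2 : algebraMap ℝ A (1 / 2) = 3 * algebraMap ℝ A (1 / 6) := by
    rw [← map_ofNat (algebraMap ℝ A) 3, ← map_mul]; norm_num
  have h3 : algebraMap ℝ A (1 / 3) = 2 * algebraMap ℝ A (1 / 6) := by
    rw [← map_ofNat (algebraMap ℝ A) 2, ← map_mul]; norm_num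
  have h6 : 6 * algebraMap ℝ A (1 / 6) = 1 := by
    rw [← map_ofNat (algebraMap ℝ A) 6, ← map_mul]; norm_num
  have hswap (x y z : Γ) : C.pairing (C.dorfman x y) z + C.pairing (C.dorfman y x) z
      = C.pairing (D.cov (C.anchor z) x) y + C.pairing (D.cov (C.anchor z) y) x := by
    rw [C.pairing_dorfman_add_swap, hD, C.pairing_symm x]
  have hskew (x y z : Γ) : C.pairing (C.dorfman x y) z + C.pairing (C.dorfman x z) y
      = C.pairing (D.cov (C.anchor x) y) z + C.pairing (D.cov (C.anchor x) z) y := by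
    rw [C.pairing_symm (C.dorfman x z), ← C.anchor_pairing, hD, C.pairing_symm y]
  simp only [torsion, torsionTerm, pairing_courantBracket, Algebra.smul_def, map_sub,
    LinearMap.sub_apply]
  rw [h2, h3]
  generalize algebraMap ℝ A (1 / 6) = w at h6
  have e1 := hswap a b c
  have e2 := hskew a b c
  have e3 := hskew b a c
  have e4 := hswap a c b
  have e5 := hswap b c a
  linear_combination (-w) * (3 * e1 + 2 * e2 - 2 * e3 - e4 + e5)
    + (C.pairing (C.dorfman a b) c - C.pairing (D.cov (C.anchor a) b) c
      + C.pairing (D.cov (C.anchor b) a) c - C.pairing (D.cov (C.anchor c) a) b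
      + w * (C.pairing (C.dorfman a b) c - C.pairing (C.dorfman b a) c
        + C.pairing (C.dorfman b c) a - C.pairing (C.dorfman c b) a
        + C.pairing (C.dorfman c a) b - C.pairing (C.dorfman a c) b)) * h6

theorem torsion_rotate (a b c : Γ) : C.torsion D a b c = C.torsion D b c a := by
  rw [torsion, torsion]; ring

/-- `v ↦ ⟨D_v s, t⟩` as a linear form. -/
def covPairing (D : LinearConnection A Γ) (s t : Γ) : VectorFields A →ₗ[A] A where
  toFun v := C.pairing (D.cov v s) t
  map_add' u v := by rw [D.cov_add_left, map_add, LinearMap.add_apply]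
  map_smul' f v := by
    rw [D.cov_smul_left, map_smul, LinearMap.smul_apply, RingHom.id_apply]

/-- Metricity removes the second covariant derivatives: what remains are derivatives of the
coefficients ⟨D s, t⟩ and pairings of first derivatives. -/
theorem pairing_curvature (hD : C.IsMetricConnection D) (u v : VectorFields A) (s t : Γ) :
    C.pairing (D.curvature u v s) t
      = u (C.pairing (D.cov v s) t) - C.pairing (D.cov v s) (D.cov u t)
        - v (C.pairing (D.cov u s) t) + C.pairing (D.cov u s) (D.cov v t)
        - C.pairing (D.cov ⁅u, v⁆ s) t := by
  rw [hD u, hD v, LinearConnection.curvature, map_sub, map_sub, LinearMap.sub_apply,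
    LinearMap.sub_apply]
  ring

end Algebraic

end CourantAlgebroid

namespace BaseMetric

variable {A : Type*} [CommRing A] [Algebra ℝ A] (g : BaseMetric A)

theorem form_grad (f : A) (v : VectorFields A) : g.form (g.grad f) v = v f :=
  LinearMap.congr_fun ((LinearEquiv.ofBijective g.form
    g.form_nondegenerate).apply_symm_apply (differential f)) v

theorem cometric_symm (f h : A) : g.cometric f h = g.cometric h f := by
  rw [cometric, cometric, ← g.form_grad h, ← g.form_grad f, g.form_symm]

end BaseMetric

/-- The condition ᴱD g = 0 tested on two gradients. Each commutator [ρ(e), grad f] applied to h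
contains ρ(e) of the cometric once more, which is why that term changes sides. -/
theorem CourantAlgebroid.PreservesMetric.anchor_cometric {A Γ : Type*} [CommRing A] [Algebra ℝ A]
    [AddCommGroup Γ] [Module ℝ Γ] [Module A Γ] {C : CourantAlgebroid A Γ}
    {D : LinearConnection A Γ} {g : BaseMetric A} (hg : C.PreservesMetric D g) (e : Γ) (f h : A) :
    C.anchor e (g.cometric f h)
      = (g.grad f (C.anchor e h) - C.anchor (D.cov (g.grad f) e) h)
        + (g.grad h (C.anchor e f) - C.anchor (D.cov (g.grad h) e) f) := by
  have h1 := hg e (g.grad f) (g.grad h)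
  rw [g.form_symm (C.baseConnection D e _) (g.grad h), g.form_grad, g.form_grad, g.form_grad,
    CourantAlgebroid.baseConnection, CourantAlgebroid.baseConnection, Derivation.add_apply,
    Derivation.add_apply, Derivation.commutator_apply, Derivation.commutator_apply] at h1
  have h2 := g.cometric_symm f h
  rw [BaseMetric.cometric, BaseMetric.cometric] at h2
  rw [BaseMetric.cometric]
  rw [← h2] at h1
  linear_combination -h1

variable {n r : ℕ} {M : Type*} [TopologicalSpace M] [ChartedSpace (EuclideanSpace ℝ (Fin n)) M]

/-- Linear forms on vector fields are local. -/
theorem restr_linear_eq_zero [T2Space M] [IsManifold (𝓡 n) ∞ M] {U : TopologicalSpace.Opens M}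
    (L : VectorFields (SmoothFn n M) →ₗ[SmoothFn n M] SmoothFn n M)
    {w : VectorFields (SmoothFn n M)} (hw : ∀ f, restr U (w f) = 0) : restr U (L w) = 0 := by
  ext ⟨y, hy⟩
  -- The bump function is 1 near y and supported in U, so φ w vanishes on all of M although w
  -- vanishes only on U. A-linearity of L then gives φ L(w) = 0.
  obtain ⟨φ, -, hφ⟩ := (SmoothBumpFunction.nhds_basis_support (I := 𝓡 n)
    (U.isOpen.mem_nhds hy)).mem_iff.mp (U.isOpen.mem_nhds hy)
  let F : SmoothFn n M := ⟨φ, φ.contMDiff⟩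
  have hF : F • w = 0 := by
    ext f x
    change φ x * w f x = 0
    by_cases hx : x ∈ U
    · have := congrArg (fun h : SmoothFn n U => h ⟨x, hx⟩) (hw f)
      have h0 : w f x = 0 := this
      rw [h0, mul_zero]
    · rw [Function.notMem_support.mp fun h => hx (hφ h), zero_mul]
  have h := congrArg L hF
  rw [map_smul, map_zero] at h
  have h1 : φ y * L w y = 0 := congrArg (fun h : SmoothFn n M => h y) h
  rw [φ.eq_one, one_mul] at h1
  exact h1

end

/-! ### The master equations in a chart -/

noncomputable section

/-- Lets the rational normalizations 1/6 and 1/2 of S and H be matched at the level of coefficient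
arrays. -/
theorem LinearMap.map_eq_zero_of_eq_smul {R E F : Type*} [Semiring R] [AddCommMonoid E]
    [AddCommMonoid F] [Module R E] [Module R F] {f : E →ₗ[R] F} {x y : E} {w : R} (hy : f y = 0)
    (h : x = w • y) : f x = 0 := by
  rw [h, map_smul, hy, smul_zero]

section Anticommuting

variable {κ R B : Type*} [Fintype κ] [CommRing R] [Ring B] [Algebra R B]
variable {η : κ → B} (hη : ∀ a b, η a * η b = -(η b * η a))
include hη

/-- Antisymmetrization of the Jacobi identity. -/
theorem quarticSum_eq_zero_of_jacobi {P W : κ → κ → κ → κ → R}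
    (h : ∀ a b c d, P a b c d + P c a b d - P d a b c - P b a c d
      = W b c a d + W a b c d - W a c b d) :
    quarticSum η ((4 : R) • P - (3 : R) • W) = 0 := by
  have h1 : P + (fun a b c d => P c a b d) - (fun a b c d => P d a b c) - (fun a b c d => P b a c d)
      - (fun a b c d => W b c a d) - W + (fun a b c d => W a c b d) = 0 := by
    ext a b c d
    simp only [Pi.sub_apply, Pi.add_apply, Pi.zero_apply]
    linear_combination h a b c d
  have h2 := congrArg (quarticSum η) h1
  have e1 : quarticSum η (fun a b c d => P c a b d) = quarticSum η P := by
    rw [quarticSum_swap₂₃ hη (fun a b c d => P b a c d), quarticSum_swap₁₂ hη, neg_neg]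
  have e2 : quarticSum η (fun a b c d => P d a b c) = -quarticSum η P := by
    rw [quarticSum_swap₃₄ hη (fun a b c d => P c a b d), e1]
  have e3 : quarticSum η (fun a b c d => W b c a d) = quarticSum η W := by
    rw [quarticSum_swap₁₂ hη (fun a b c d => W a c b d), quarticSum_swap₂₃ hη, neg_neg]
  simp only [map_add, map_sub, e1, e2, e3, quarticSum_swap₁₂ hη P, quarticSum_swap₂₃ hη W,
    map_zero] at h2
  rw [map_sub, map_smul, map_smul, ← h2]
  module

end Anticommuting

variable {n r : ℕ} {M : Type*} [TopologicalSpace M] [ChartedSpace (EuclideanSpace ℝ (Fin n)) M]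
  {V : M → Type*} [TopologicalSpace (Bundle.TotalSpace (EuclideanSpace ℝ (Fin r)) V)]
  [∀ x, AddCommGroup (V x)] [∀ x, Module ℝ (V x)] [∀ x, TopologicalSpace (V x)]
  [FiberBundle (EuclideanSpace ℝ (Fin r)) V] [VectorBundle ℝ (EuclideanSpace ℝ (Fin r)) V]
  {C : CourantAlgebroid (SmoothFn n M) (SmoothSec n r V)}

namespace DarbouxChart

variable (c : DarbouxChart C) {D : LinearConnection (SmoothFn n M) (SmoothSec n r V)}

/-- By `field_expand` the difference v - ∑ v(xⁱ) ∂ᵢ kills all functions on U, so locality of linear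
forms applies to it. -/
theorem restr_linear [T2Space M] [IsManifold (𝓡 n) ∞ M]
    (L : VectorFields (SmoothFn n M) →ₗ[SmoothFn n M] SmoothFn n M)
    (v : VectorFields (SmoothFn n M)) :
    restr c.U (L v) = ∑ i, restr c.U (v (c.x i)) * restr c.U (L (c.field i)) := by
  have h := restr_linear_eq_zero (U := c.U) L (w := v - ∑ i, v (c.x i) • c.field i) fun f => by
    change restr c.U (differential f (v - ∑ i, v (c.x i) • c.field i)) = 0
    rw [map_sub, map_sum, map_sub, map_sum, sub_eq_zero]
    refine (c.field_expand v f).trans (Finset.sum_congr rfl fun i _ => ?_)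
    rw [map_smul, smul_eq_mul, map_mul]
    rfl
  rw [map_sub, map_sub, sub_eq_zero, map_sum, map_sum] at h
  rw [h]
  refine Finset.sum_congr rfl fun i _ => ?_
  rw [map_smul, smul_eq_mul, map_mul]

theorem restr_pairing_cov [T2Space M] [IsManifold (𝓡 n) ∞ M]
    (v : VectorFields (SmoothFn n M)) (a b : Fin r) :
    restr c.U (C.pairing (D.cov v (c.e a)) (c.e b))
      = ∑ i, restr c.U (v (c.x i)) * c.connectionCoeff D i a b :=
  c.restr_linear (C.covPairing D (c.e a) (c.e b)) v

/-- `⟨D_{ρ(e_a)} e_b, e_d⟩` on `U`. -/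
def anchoredCoeff (D : LinearConnection (SmoothFn n M) (SmoothSec n r V)) (a b d : Fin r) :
    SmoothFn n c.U := restr c.U (C.pairing (D.cov (C.anchor (c.e a)) (c.e b)) (c.e d))

theorem anchoredCoeff_eq [T2Space M] [IsManifold (𝓡 n) ∞ M] (a b d : Fin r) :
    c.anchoredCoeff D a b d = ∑ i, c.anchorCoeff a i * c.connectionCoeff D i b d :=
  c.restr_pairing_cov _ _ _

/-- Needed for s = D_{∂ᵢ} e_d, a section outside the frame that enters the derivative of the torsion
through the direction ρ(s). -/
theorem restr_pairing_cov_anchor [T2Space M] [IsManifold (𝓡 n) ∞ M]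
    (s : SmoothSec n r V) (a b : Fin r) :
    restr c.U (C.pairing (D.cov (C.anchor s) (c.e a)) (c.e b))
      = ∑ g, ∑ h, c.inverseGram g h
        * (c.anchoredCoeff D g a b * restr c.U (C.pairing (c.e h) s)) := by
  rw [c.restr_pairing_cov]
  simp only [anchoredCoeff_eq, c.restr_anchor_section s, Finset.sum_mul, Finset.mul_sum]
  rw [Finset.sum_comm, Finset.sum_comm]
  calc _ = ∑ i, ∑ g, ∑ h, c.inverseGram h g * (restr c.U (C.pairing s (c.e h))
            * restr c.U (C.anchor (c.e g) (c.x i))) * c.connectionCoeff D i a b :=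
          Finset.sum_congr rfl fun i _ => Finset.sum_comm
    _ = ∑ g, ∑ h, ∑ i, c.inverseGram h g * (restr c.U (C.pairing s (c.e h))
            * restr c.U (C.anchor (c.e g) (c.x i))) * c.connectionCoeff D i a b := by
          rw [Finset.sum_comm]
          exact Finset.sum_congr rfl fun g _ => Finset.sum_comm
    _ = _ := by
      refine Finset.sum_congr rfl fun g _ => Finset.sum_congr rfl fun h _ =>
        Finset.sum_congr rfl fun i _ => ?_
      rw [c.inverseGram_symm, C.pairing_symm s, anchorCoeff]
      ring

/-- `∑ kᵍʰ F_abg Γ_idh`. -/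
def contractConnection (D : LinearConnection (SmoothFn n M) (SmoothSec n r V)) (i : Fin n)
    (F : Fin r → Fin r → Fin r → SmoothFn n c.U) (a b d : Fin r) : SmoothFn n c.U :=
  ∑ g, ∑ h, c.inverseGram g h * (F a b g * c.connectionCoeff D i d h)

theorem restr_pairing_cov_right (i : Fin n) (s : SmoothSec n r V) (d : Fin r) :
    restr c.U (C.pairing s (D.cov (c.field i) (c.e d)))
      = ∑ g, ∑ h, c.inverseGram g h
        * (restr c.U (C.pairing s (c.e g)) * c.connectionCoeff D i d h) := by
  rw [c.restr_pairing]
  simp only [C.pairing_symm (c.e _) (D.cov _ _)]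
  rfl

variable [T2Space M] [IsManifold (𝓡 n) ∞ M]

theorem restr_torsion_cov (hD : C.IsMetricConnection D) (i : Fin n) (a b d : Fin r) :
    restr c.U (C.torsion D (c.e a) (c.e b) (D.cov (c.field i) (c.e d)))
      = c.contractConnection D i c.structureFn a b d
        - c.contractConnection D i (c.anchoredCoeff D) a b d
        + c.contractConnection D i (c.anchoredCoeff D) b a d
        - c.contractConnection D i (fun a b g => c.anchoredCoeff D g a b) a b d := by
  rw [C.torsion_eq hD, map_sub, map_add, map_sub, c.restr_pairing_cov_right,
    c.restr_pairing_cov_right, c.restr_pairing_cov_right, c.restr_pairing_cov_anchor]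
  simp only [C.pairing_symm (c.e _) (D.cov _ _)]
  rfl

theorem restr_torsion (hD : C.IsMetricConnection D) (a b d : Fin r) :
    restr c.U (C.torsion D (c.e a) (c.e b) (c.e d)) = c.structureFn a b d
      - c.anchoredCoeff D a b d + c.anchoredCoeff D b a d - c.anchoredCoeff D d a b := by
  rw [C.torsion_eq hD, map_sub, map_add, map_sub]
  rfl

theorem restr_lie_field (i j : Fin n) (a : Fin r) :
    restr c.U (⁅c.field i, C.anchor (c.e a)⁆ (c.x j)) = c.dx i (c.anchorCoeff a j) := by
  rw [Derivation.commutator_apply, map_sub, ← c.dx_restr, c.restr_anchor a (c.field i (c.x j)),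
    c.field_x]
  -- ∂ᵢxʲ is constant on U, so the second half of the commutator drops out.
  have h (k : Fin n) : c.dx k (if i = j then 1 else 0) = 0 := by split_ifs <;> simp
  simp only [h, mul_zero, Finset.sum_const_zero, sub_zero]
  rfl

theorem restr_curvature (hD : C.IsMetricConnection D) (i : Fin n) (a b d : Fin r) :
    restr c.U (C.pairing (D.curvature (c.field i) (C.anchor (c.e a)) (c.e b)) (c.e d))
      = c.dx i (c.anchoredCoeff D a b d) - c.contractConnection D i (c.anchoredCoeff D) a b d
        - ∑ j, c.anchorCoeff a j * c.dx j (c.connectionCoeff D i b d)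
        + c.contractConnection D i (c.anchoredCoeff D) a d b
        - ∑ j, c.dx i (c.anchorCoeff a j) * c.connectionCoeff D j b d := by
  rw [C.pairing_curvature hD, C.pairing_symm (D.cov (c.field i) (c.e b)) (D.cov _ (c.e d)),
    map_sub, map_add, map_sub, map_sub, ← c.dx_restr,
    c.restr_pairing_cov_right i (D.cov (C.anchor (c.e a)) (c.e b)) d,
    c.restr_anchor a (C.pairing (D.cov (c.field i) (c.e b)) (c.e d)),
    c.restr_pairing_cov_right i (D.cov (C.anchor (c.e a)) (c.e d)) b, c.restr_pairing_cov ⁅c.field i, C.anchor (c.e a)⁆]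
  simp only [c.restr_lie_field]
  rfl

/-- The basic curvature on frame sections, contracted with three η. The coefficients ⟨D_{ρ(e_a)}
e_b, e_d⟩ survive only where the anchor is applied to a derivative of a frame section. -/
theorem cubicSum_basicCurvature (hD : C.IsMetricConnection D) (hS : C.IsCartan D) (i : Fin n) :
    cubicSum c.darbouxAlgebra.η ((fun a b d => c.dx i (c.structureFn a b d))
      - (3 : SmoothFn n c.U) • c.contractConnection D i c.structureFn
      + (3 : SmoothFn n c.U) • c.contractConnection D i (fun a b g => c.anchoredCoeff D g a b)
      - (3 : SmoothFn n c.U) • (fun a b d =>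
          ∑ j, c.anchorCoeff a j * c.dx j (c.connectionCoeff D i b d))
      - (3 : SmoothFn n c.U) • (fun a b d =>
          ∑ j, c.dx i (c.anchorCoeff a j) * c.connectionCoeff D j b d)) = 0 := by
  refine cubicSum_eq_zero_of_basicCurvature c.darbouxAlgebra.η_mul_η
    (dA := fun a b d => c.dx i (c.anchoredCoeff D a b d))
    (tA := c.contractConnection D i (c.anchoredCoeff D)) fun a b d => ?_
  have h := congrArg (restr c.U) (hS (c.field i) (c.e a) (c.e b) (c.e d))
  rw [CourantAlgebroid.basicCurvature, C.torsion_rotate (D.cov _ _),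
    ← C.torsion_rotate (c.e d) (c.e a) (D.cov _ _)] at h
  simp only [map_add, map_sub, map_zero] at h
  rw [← c.dx_restr, c.restr_torsion hD, c.restr_torsion_cov hD, c.restr_torsion_cov hD,
    c.restr_torsion_cov hD, c.restr_curvature hD, c.restr_curvature hD, c.restr_curvature hD] at h
  simp only [map_add, map_sub] at h
  linear_combination h

theorem poisson_bfvCharge_bfvCharge : c.poisson c.bfvCharge c.bfvCharge = 0 := by
  rw [c.poisson_eq, c.bfvCharge_eq]
  have h6 : algebraMap ℝ (SmoothFn n c.U) (1 / 6) * 6 = 1 := by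
    rw [← map_ofNat (algebraMap ℝ (SmoothFn n c.U)) 6, ← map_mul]; norm_num
  refine DarbouxAlgebra.poisson_charge_charge c.inverseGram_symm
    (fun a b d => by rw [c.structureFn_swap₁₂, smul_neg])
    (fun a b d => by rw [c.structureFn_swap₂₃, smul_neg])
    (fun i j => c.inverseGram_anchor_anchor (c.x i) (c.x j)) (fun a b j => ?_) ?_
  · refine (c.anchorCoeff_bracket a b j).trans ?_
    refine Finset.sum_congr rfl fun g _ => Finset.sum_congr rfl fun h _ => ?_
    rw [Algebra.smul_def]
    change _ = c.inverseGram g h * _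
    linear_combination (-c.inverseGram g h * c.anchorCoeff g j * c.structureFn h a b) * h6
  · have h := quarticSum_eq_zero_of_jacobi c.darbouxAlgebra.η_mul_η c.structureFn_jacobi
    -- With F = f/6 the required η⁴ coefficient is 2·(1/6) P - 9·(1/36) W = (4P - 3W)/12, where P =
    -- ρ∂f and W = kff are the arrays of `quarticSum_eq_zero_of_jacobi`.
    set w : SmoothFn n c.U := algebraMap ℝ _ (1 / 12) with hw
    have h12 : 12 * w = 1 := by
      rw [hw, ← map_ofNat (algebraMap ℝ (SmoothFn n c.U)) 12, ← map_mul]; norm_num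
    have hw6 (f : SmoothFn n c.U) : (1 / 6 : ℝ) • f = 2 * w * f := by
      rw [hw, ← map_ofNat (algebraMap ℝ (SmoothFn n c.U)) 2, ← map_mul, ← Algebra.smul_def]
      norm_num
    refine LinearMap.map_eq_zero_of_eq_smul (w := w) h ?_
    funext a b d e
    simp only [Pi.smul_apply, Pi.sub_apply, smul_eq_mul]
    have e1 : ∑ i, c.anchorCoeff a i * c.dx i ((1 / 6 : ℝ) • c.structureFn b d e)
        = 2 * w * ∑ i, c.anchorCoeff a i * c.dx i (c.structureFn b d e) := by
      rw [Finset.mul_sum]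
      refine Finset.sum_congr rfl fun i _ => ?_
      rw [Derivation.map_smul, hw6]
      ring
    have e2 : ∑ g, ∑ h, c.inverseGram g h
          * (((1 / 6 : ℝ) • c.structureFn g a b) * ((1 / 6 : ℝ) • c.structureFn h d e))
        = (2 * w) * (2 * w) * ∑ g, ∑ h, c.inverseGram g h
          * (c.structureFn g a b * c.structureFn h d e) := by
      simp only [Finset.mul_sum]
      refine Finset.sum_congr rfl fun g _ => Finset.sum_congr rfl fun h _ => ?_
      rw [hw6, hw6]
      ring
    refine (congrArg₂ (fun x y => 2 * x - 9 * y) e1 e2).trans ?_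
    linear_combination (-3 * w * ∑ g, ∑ h, c.inverseGram g h
          * (c.structureFn g a b * c.structureFn h d e)) * h12

/-- `∂ᵢ ρʲ_a + kᵍʰ ρʲ_g Γ_iha`. -/
theorem anchorDerivative_eq (i j : Fin n) (a : Fin r) :
    c.darbouxAlgebra.anchorDerivative c.inverseGram c.anchorCoeff
      (fun i a b => (1 / 2 : ℝ) • c.connectionCoeff D i a b) i j a
    = c.dx i (c.anchorCoeff a j)
      + ∑ g, ∑ h, c.inverseGram g h * (c.anchorCoeff g j * c.connectionCoeff D i h a) := by
  rw [DarbouxAlgebra.anchorDerivative]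
  congr 1
  refine Finset.sum_congr rfl fun g _ => Finset.sum_congr rfl fun h _ => ?_
  rw [mul_smul_comm, two_mul, ← two_smul ℝ, smul_smul]
  norm_num

/-- The second term is ⟨D_{ρ(D_{∂ᵢ} e_a)} e_b, e_d⟩. Its sign comes from the antisymmetry of Γ,
since `anchorDerivative` contracts the other index. -/
theorem sum_anchorDerivative_mul (hD : C.IsMetricConnection D) (i : Fin n) (a b d : Fin r) :
    ∑ j, c.darbouxAlgebra.anchorDerivative c.inverseGram c.anchorCoeff
      (fun i a b => (1 / 2 : ℝ) • c.connectionCoeff D i a b) i j a * c.connectionCoeff D j b d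
    = ∑ j, c.dx i (c.anchorCoeff a j) * c.connectionCoeff D j b d
      - c.contractConnection D i (fun a b g => c.anchoredCoeff D g a b) b d a := by
  simp only [anchorDerivative_eq, add_mul, Finset.sum_add_distrib, contractConnection,
    anchoredCoeff_eq, Finset.sum_mul, Finset.mul_sum, sub_eq_add_neg, ← Finset.sum_neg_distrib]
  congr 1
  rw [Finset.sum_comm]
  refine Finset.sum_congr rfl fun g _ => ?_
  rw [Finset.sum_comm]
  refine Finset.sum_congr rfl fun h _ => Finset.sum_congr rfl fun j _ => ?_
  rw [c.connectionCoeff_swap hD i h a]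
  ring

/-- This is `anchor_cometric` on coordinate functions, whose gradients have components gⁱˡ. -/
theorem sum_anchorCoeff_mul_dx_cometricCoeff (hD : C.IsMetricConnection D)
    {g : BaseMetric (SmoothFn n M)} (hg : C.PreservesMetric D g) (a : Fin r) (i j : Fin n) :
    ∑ k, c.anchorCoeff a k * c.dx k (c.cometricCoeff g i j)
      = ∑ l, c.cometricCoeff g i l * c.darbouxAlgebra.anchorDerivative c.inverseGram c.anchorCoeff
          (fun i a b => (1 / 2 : ℝ) • c.connectionCoeff D i a b) l j a
        + ∑ l, c.cometricCoeff g j l * c.darbouxAlgebra.anchorDerivative c.inverseGram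
          c.anchorCoeff (fun i a b => (1 / 2 : ℝ) • c.connectionCoeff D i a b) l i a := by
  have key (i j : Fin n) : restr c.U (g.grad (c.x i) (C.anchor (c.e a) (c.x j))
        - C.anchor (D.cov (g.grad (c.x i)) (c.e a)) (c.x j))
      = ∑ l, c.cometricCoeff g i l * c.darbouxAlgebra.anchorDerivative c.inverseGram c.anchorCoeff
          (fun i a b => (1 / 2 : ℝ) • c.connectionCoeff D i a b) l j a := by
    rw [map_sub, c.restr_field, c.restr_anchor_section (D.cov (g.grad (c.x i)) (c.e a))]
    simp only [anchorDerivative_eq, mul_add, Finset.sum_add_distrib, c.restr_pairing_cov,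
      sub_eq_add_neg, Finset.sum_mul, Finset.mul_sum, ← Finset.sum_neg_distrib]
    congr 1
    symm
    rw [Finset.sum_comm, Finset.sum_comm]
    calc _ = ∑ l, ∑ p, ∑ q, c.cometricCoeff g i l * (c.inverseGram q p
            * (c.anchorCoeff q j * c.connectionCoeff D l p a)) :=
          Finset.sum_congr rfl fun l _ => Finset.sum_comm
      _ = ∑ p, ∑ q, ∑ l, c.cometricCoeff g i l * (c.inverseGram q p
            * (c.anchorCoeff q j * c.connectionCoeff D l p a)) := by
          rw [Finset.sum_comm]
          exact Finset.sum_congr rfl fun p _ => Finset.sum_comm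
      _ = _ := by
        refine Finset.sum_congr rfl fun p _ => Finset.sum_congr rfl fun q _ =>
          Finset.sum_congr rfl fun l _ => ?_
        rw [c.inverseGram_symm q p, c.connectionCoeff_swap hD l p a, cometricCoeff,
          BaseMetric.cometric, anchorCoeff]
        ring
  rw [← key, ← key, ← map_add, ← hg.anchor_cometric, c.restr_anchor]
  rfl

theorem poisson_bfvCharge_bfvHamiltonian (hD : C.IsMetricConnection D) (hS : C.IsCartan D)
    {g : BaseMetric (SmoothFn n M)} (hg : C.PreservesMetric D g) :
    c.poisson c.bfvCharge (c.bfvHamiltonian D g 0) = 0 := by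
  rw [c.poisson_eq, c.bfvCharge_eq, c.bfvHamiltonian_eq]
  refine DarbouxAlgebra.poisson_charge_hamiltonian
    (fun a b d => by rw [c.structureFn_swap₁₂, smul_neg])
    (fun a b d => by rw [c.structureFn_swap₂₃, smul_neg])
    (fun i a b => by rw [c.connectionCoeff_swap hD, smul_neg]) (fun i => ?_)
    (fun i => Derivation.map_algebraMap _ _)
    (fun i j => by rw [cometricCoeff, g.cometric_symm, cometricCoeff])
    (fun a i j => c.sum_anchorCoeff_mul_dx_cometricCoeff hD hg a i j)
  set w : SmoothFn n c.U := algebraMap ℝ _ (1 / 6) with hw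
  have h6 : 6 * w = 1 := by
    rw [hw, ← map_ofNat (algebraMap ℝ (SmoothFn n c.U)) 6, ← map_mul]; norm_num
  have hw2 (f : SmoothFn n c.U) : (1 / 2 : ℝ) • f = 3 * w * f := by
    rw [hw, ← map_ofNat (algebraMap ℝ (SmoothFn n c.U)) 3, ← map_mul, ← Algebra.smul_def]
    norm_num
  have hw6 (f : SmoothFn n c.U) : (1 / 6 : ℝ) • f = w * f := Algebra.smul_def _ _
  set tB := c.contractConnection D i (fun a b g => c.anchoredCoeff D g a b) with htB
  have h := c.cubicSum_basicCurvature hD hS i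
  rw [← htB] at h
  -- Only the rotated array b, d, a appears in `sum_anchorDerivative_mul`; a rotation does not
  -- change the cubic sum.
  have h' : cubicSum c.darbouxAlgebra.η ((fun a b d => c.dx i (c.structureFn a b d))
      - (3 : SmoothFn n c.U) • c.contractConnection D i c.structureFn
      + (3 : SmoothFn n c.U) • (fun a b d => tB b d a)
      - (3 : SmoothFn n c.U) • (fun a b d =>
          ∑ j, c.anchorCoeff a j * c.dx j (c.connectionCoeff D i b d))
      - (3 : SmoothFn n c.U) • (fun a b d =>
          ∑ j, c.dx i (c.anchorCoeff a j) * c.connectionCoeff D j b d)) = 0 := by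
    simp only [map_sub, map_add, map_smul] at h ⊢
    rwa [cubicSum_rotate c.darbouxAlgebra.η_mul_η tB]
  refine LinearMap.map_eq_zero_of_eq_smul (w := w) h' ?_
  funext a b d
  simp only [Pi.smul_apply, Pi.sub_apply, Pi.add_apply, smul_eq_mul]
  have e1 : c.dx i ((1 / 6 : ℝ) • c.structureFn a b d) = w * c.dx i (c.structureFn a b d) := by
    rw [Derivation.map_smul, hw6]
  have e2 : ∑ j, c.anchorCoeff a j * c.dx j ((1 / 2 : ℝ) • c.connectionCoeff D i b d)
      = 3 * w * ∑ j, c.anchorCoeff a j * c.dx j (c.connectionCoeff D i b d) := by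
    rw [Finset.mul_sum]
    refine Finset.sum_congr rfl fun j _ => ?_
    rw [Derivation.map_smul, hw2]
    ring
  have e3 : ∑ g, ∑ h, c.inverseGram g h
        * (((1 / 6 : ℝ) • c.structureFn g a b) * ((1 / 2 : ℝ) • c.connectionCoeff D i h d))
      = -(w * (3 * w) * c.contractConnection D i c.structureFn a b d) := by
    simp only [contractConnection, Finset.mul_sum, ← Finset.sum_neg_distrib]
    refine Finset.sum_congr rfl fun g _ => Finset.sum_congr rfl fun h _ => ?_
    rw [hw6, hw2, c.connectionCoeff_swap hD i h d, c.structureFn_rotate a b g]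
    ring
  have e4 : ∑ j, c.darbouxAlgebra.anchorDerivative c.inverseGram c.anchorCoeff
        (fun i a b => (1 / 2 : ℝ) • c.connectionCoeff D i a b) i j a
          * ((1 / 2 : ℝ) • c.connectionCoeff D j b d)
      = 3 * w * (∑ j, c.dx i (c.anchorCoeff a j) * c.connectionCoeff D j b d - tB b d a) := by
    rw [htB, ← c.sum_anchorDerivative_mul hD, Finset.mul_sum]
    refine Finset.sum_congr rfl fun j _ => ?_
    rw [hw2]
    ring
  refine (congrArg₂ (fun x y => x - y) (congrArg₂ (fun x y => x + 6 * y)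
    (congrArg₂ (fun x y => x - y) e1 e2) e3) e4).trans ?_
  linear_combination (-3 * w * c.contractConnection D i c.structureFn a b d) * h6

theorem poisson_bfvHamiltonian_bfvHamiltonian (hD : C.IsMetricConnection D)
    (g : BaseMetric (SmoothFn n M)) :
    c.poisson (c.bfvHamiltonian D g 0) (c.bfvHamiltonian D g 0) = 0 := by
  rw [c.poisson_eq, c.bfvHamiltonian_eq]
  exact DarbouxAlgebra.poisson_hamiltonian_hamiltonian c.inverseGram_symm _ _
    fun i a b => by rw [c.connectionCoeff_swap hD, smul_neg]

end DarbouxChart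

end

/-! ### Algebra of the coordinate changes -/

noncomputable section

section LinearSubstitution

variable {κ R B : Type*} [Fintype κ] [CommRing R] [Ring B] [Algebra R B] (η : κ → B)

theorem linearSum_linearSum (N : κ → κ → R) (F : κ → R) :
    linearSum (fun a => linearSum η (N a)) F = linearSum η (fun d => ∑ a, F a * N a d) := by
  have h : (fun d => ∑ a, F a * N a d) = ∑ a, F a • N a := by
    ext d
    simp
  rw [h, map_sum]
  simp only [map_smul]
  rfl

theorem quadraticSum_linearSum (N : κ → κ → R) (F : κ → κ → R) :
    quadraticSum (fun a => linearSum η (N a)) F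
      = quadraticSum η (fun a b => ∑ u, ∑ v, F u v * (N u a * N v b)) := by
  have h : (fun a b => ∑ u, ∑ v, F u v * (N u a * N v b))
      = ∑ u, ∑ v, F u v • fun a b => N u a * N v b := by
    ext a b
    simp
  rw [h, map_sum]
  simp only [map_sum, map_smul, ← linearSum_mul_linearSum]
  rfl

theorem cubicSum_linearSum (N : κ → κ → R) (F : κ → κ → κ → R) :
    cubicSum (fun a => linearSum η (N a)) F
      = cubicSum η (fun a b c => ∑ u, ∑ v, ∑ w, F u v w * (N u a * (N v b * N w c))) := by
  have h : (fun a b c => ∑ u, ∑ v, ∑ w, F u v w * (N u a * (N v b * N w c)))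
      = ∑ u, ∑ v, ∑ w, F u v w • fun a b c => N u a * (N v b * N w c) := by
    ext a b c
    simp
  rw [h, map_sum]
  have h3 (u v w : κ) : cubicSum η (fun a b c => N u a * (N v b * N w c))
      = linearSum η (N u) * linearSum η (N v) * linearSum η (N w) := by
    rw [mul_assoc, linearSum_mul_linearSum, linearSum_mul_quadraticSum]
  simp only [map_sum, map_smul, h3]
  rfl

/-- `X` is the inhomogeneous part of a change of frame. The term with ½ comes from the shift of the
momenta and the three terms with 1/6 from the structure functions. After antisymmetrization the
latter coincide, and 3/6 = ½. -/
theorem cubicSum_frame_change {B : Type*} [Ring B] [Algebra ℝ B] {η : κ → B}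
    (hη : ∀ a b, η a * η b = -(η b * η a)) {X F G : κ → κ → κ → ℝ}
    (h : ∀ a b c, F a b c = G a b c + 1 / 2 * X a b c
      - 1 / 6 * (X a b c - X b a c + X c a b)) :
    cubicSum η F = cubicSum η G := by
  have h' : F = G + (1 / 2 : ℝ) • X
      - (1 / 6 : ℝ) • (X - (fun a b c => X b a c) + fun a b c => X c a b) := by
    funext a b c
    exact h a b c
  rw [h', map_sub, map_add, map_smul, map_smul, map_add, map_sub, cubicSum_swap₁₂ hη X,
    cubicSum_rotate' hη X]
  module

end LinearSubstitution

namespace DarbouxAlgebra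

variable {ι κ R B R' B' : Type*} [Fintype ι] [Fintype κ] [DecidableEq ι] [DecidableEq κ]
  [CommRing R] [Algebra ℝ R] [Ring B] [Algebra ℝ B] [Algebra R B] (Q : DarbouxAlgebra ι κ R B)
  [CommRing R'] [Ring B'] [Algebra R' B'] {χ : R → R'} {φ : B →+ B'}
  (hmul : ∀ X Y, φ (X * Y) = φ X * φ Y) (hsmul : ∀ f X, φ (f • X) = χ f • φ X)
include hmul hsmul

theorem map_charge (ρ : κ → ι → R) (F : κ → κ → κ → R) : φ (Q.charge ρ F)
    = ∑ j, linearSum (fun a => φ (Q.η a)) (fun a => χ (ρ a j)) * φ (Q.p j)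
      + cubicSum (fun a => φ (Q.η a)) (fun a b c => χ (F a b c)) := by
  simp [charge, linearSum, cubicSum, hmul, hsmul]

theorem map_shiftedMomentum (F : κ → κ → R) (j : ι) : φ (Q.shiftedMomentum F j)
    = φ (Q.p j) + quadraticSum (fun a => φ (Q.η a)) (fun a b => χ (F a b)) := by
  simp [shiftedMomentum, quadraticSum, hmul, hsmul]

theorem map_hamiltonian (h : R) (g : ι → ι → R) (F : ι → κ → κ → R) :
    φ (Q.hamiltonian h g F) = χ h • ∑ j, ∑ k, χ (g j k)
      • (φ (Q.shiftedMomentum (F j) j) * φ (Q.shiftedMomentum (F k) k)) := by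
  rw [hamiltonian, hsmul, map_sum]
  simp only [map_sum, hsmul, hmul]

theorem map_charge_of_eq {e : κ → B'} {N : κ → κ → R'} (hη : ∀ a, φ (Q.η a) = linearSum e (N a))
    {P : ι → B'} {J : ι → ι → R'} {E : ι → κ → κ → R'}
    (hp : ∀ j, φ (Q.p j) = ∑ i, J j i • P i + quadraticSum e (E j))
    (ρ : κ → ι → R) (F : κ → κ → κ → R) : φ (Q.charge ρ F)
      = ∑ i, linearSum e (fun d => ∑ j, (∑ a, χ (ρ a j) * N a d) * J j i) * P i
        + cubicSum e (fun a b d => ∑ j, (∑ u, χ (ρ u j) * N u a) * E j b d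
          + ∑ u, ∑ v, ∑ w, χ (F u v w) * (N u a * (N v b * N w d))) := by
  have h1 (i : ι) : linearSum e (fun d => ∑ j, (∑ a, χ (ρ a j) * N a d) * J j i)
      = ∑ j, J j i • linearSum e (fun d => ∑ a, χ (ρ a j) * N a d) := by
    rw [show (fun d => ∑ j, (∑ a, χ (ρ a j) * N a d) * J j i)
      = ∑ j, J j i • fun d => ∑ a, χ (ρ a j) * N a d by
        funext d
        simp [mul_comm], map_sum]
    simp only [map_smul]
  have h2 : (fun a b d => ∑ j, (∑ u, χ (ρ u j) * N u a) * E j b d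
        + ∑ u, ∑ v, ∑ w, χ (F u v w) * (N u a * (N v b * N w d)))
      = ∑ j, (fun a b d => (∑ u, χ (ρ u j) * N u a) * E j b d)
        + fun a b d => ∑ u, ∑ v, ∑ w, χ (F u v w) * (N u a * (N v b * N w d)) := by
    funext a b d
    simp
  rw [Q.map_charge hmul hsmul, funext hη, cubicSum_linearSum, h2, map_add, map_sum, ← add_assoc]
  congr 1
  simp only [h1, hp, linearSum_linearSum, mul_add, Finset.sum_add_distrib,
    linearSum_mul_quadraticSum]
  congr 1
  simp only [Finset.sum_mul, Finset.mul_sum, mul_smul_comm, smul_mul_assoc]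
  exact Finset.sum_comm

theorem map_shiftedMomentum_of_eq {e : κ → B'} {N : κ → κ → R'}
    (hη : ∀ a, φ (Q.η a) = linearSum e (N a))
    {P : ι → B'} {J : ι → ι → R'} {E : ι → κ → κ → R'}
    (hp : ∀ j, φ (Q.p j) = ∑ i, J j i • P i + quadraticSum e (E j))
    {F : κ → κ → R} {F' : ι → κ → κ → R'} {j : ι} (hF : ∀ a b, E j a b
      + ∑ u, ∑ v, χ (F u v) * (N u a * N v b) = ∑ i, J j i * F' i a b) :
    φ (Q.shiftedMomentum F j) = ∑ i, J j i • (P i + quadraticSum e (F' i)) := by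
  have h1 : ∑ i, J j i • F' i
      = E j + fun a b => ∑ u, ∑ v, χ (F u v) * (N u a * N v b) := by
    funext a b
    simpa using (hF a b).symm
  simp only [smul_add, Finset.sum_add_distrib, ← map_smul (quadraticSum e), ← map_sum]
  rw [Q.map_shiftedMomentum hmul hsmul, hp, funext hη, quadraticSum_linearSum, h1, map_add,
    add_assoc]

theorem map_hamiltonian_of_eq {h : R} {g : ι → ι → R} {F : ι → κ → κ → R} {P : ι → B'}
    {J : ι → ι → R'} (hP : ∀ j, φ (Q.shiftedMomentum (F j) j) = ∑ i, J j i • P i) :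
    φ (Q.hamiltonian h g F)
      = χ h • ∑ i, ∑ l, (∑ j, ∑ k, χ (g j k) * (J j i * J k l)) • (P i * P l) := by
  rw [Q.map_hamiltonian hmul hsmul]
  congr 1
  simp only [hP, Finset.sum_mul_sum, Finset.smul_sum, Finset.sum_smul, smul_mul_smul_comm,
    smul_smul]
  calc _ = ∑ j, ∑ i, ∑ k, ∑ l, (χ (g j k) * (J j i * J k l)) • (P i * P l) :=
        Finset.sum_congr rfl fun j _ => Finset.sum_comm
    _ = ∑ i, ∑ j, ∑ l, ∑ k, (χ (g j k) * (J j i * J k l)) • (P i * P l) := by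
        rw [Finset.sum_comm]
        exact Finset.sum_congr rfl fun i _ => Finset.sum_congr rfl fun j _ => Finset.sum_comm
    _ = _ := Finset.sum_congr rfl fun i _ => Finset.sum_comm

end DarbouxAlgebra

theorem TensorProduct.map_mul_of_tmul {𝕜 A B E : Type*} [CommRing 𝕜] [Ring A] [Algebra 𝕜 A]
    [Ring B] [Algebra 𝕜 B] [Ring E] [Module 𝕜 E] {L : A ⊗[𝕜] B →ₗ[𝕜] E}
    (hL : ∀ a b a' b', L ((a * a') ⊗ₜ (b * b')) = L (a ⊗ₜ b) * L (a' ⊗ₜ b')) (X Y : A ⊗[𝕜] B) :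
    L (X * Y) = L X * L Y := by
  induction X with
  | zero => simp
  | add X X' h h' => simp only [add_mul, map_add, h, h']
  | tmul a b =>
    induction Y with
    | zero => simp
    | add Y Y' h h' => simp only [mul_add, map_add, h, h']
    | tmul a' b' => rw [Algebra.TensorProduct.tmul_mul_tmul, hL]

namespace FibreFn

variable {n r : ℕ} {P : Fin n → FibreFn n r}

/-- Images of monomials are ordered products in a noncommutative algebra. Central `P i` turn them
into polynomial evaluation in the center, which is commutative, and multiplicativity of the
substitution follows. -/
theorem subst_tmul (hP : ∀ i X, P i * X = X * P i) (N : Matrix (Fin r) (Fin r) ℝ) :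
    ∃ φ : MvPolynomial (Fin n) ℝ →ₐ[ℝ] Subalgebra.center ℝ (FibreFn n r),
      (∀ i, (φ (MvPolynomial.X i) : FibreFn n r) = P i) ∧
      ∀ q θ, subst P N (q ⊗ₜ θ)
        = (φ q : FibreFn n r) * (1 ⊗ₜ ExteriorAlgebra.map (Matrix.toLin' N.transpose) θ) := by
  let z : Fin n → Subalgebra.center ℝ (FibreFn n r) := fun i =>
    ⟨P i, Subalgebra.mem_center_iff.mpr fun X => (hP i X).symm⟩
  refine ⟨MvPolynomial.aeval z, fun i => by rw [MvPolynomial.aeval_X], fun q θ => ?_⟩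
  have h : (MvPolynomial.basisMonomials (Fin n) ℝ).constr ℝ
      (fun m => (List.ofFn fun i => P i ^ m i).prod)
      = (Subalgebra.center ℝ (FibreFn n r)).val.toLinearMap ∘ₗ
        (MvPolynomial.aeval z).toLinearMap := by
    refine (MvPolynomial.basisMonomials (Fin n) ℝ).ext fun m => ?_
    rw [Module.Basis.constr_basis, LinearMap.comp_apply, MvPolynomial.coe_basisMonomials]
    simp only [AlgHom.toLinearMap_apply, MvPolynomial.aeval_monomial, map_one, one_mul]
    rw [Finsupp.prod_fintype _ _ fun i => pow_zero _, ← List.prod_ofFn, map_list_prod,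
      List.map_ofFn]
    rfl
  rw [subst, TensorProduct.lift.tmul, LinearMap.compl₁₂_apply, h]
  rfl

theorem subst_mul (hP : ∀ i X, P i * X = X * P i) (N : Matrix (Fin r) (Fin r) ℝ)
    (X Y : FibreFn n r) : subst P N (X * Y) = subst P N X * subst P N Y := by
  obtain ⟨φ, -, hφ⟩ := subst_tmul hP N
  refine TensorProduct.map_mul_of_tmul (fun q θ q' θ' => ?_) X Y
  have hc : ∀ X, (φ q' : FibreFn n r) * X = X * φ q' := fun X =>
    (Subalgebra.mem_center_iff.mp (φ q').2 X).symm
  have h1 : (1 ⊗ₜ ExteriorAlgebra.map (Matrix.toLin' N.transpose) (θ * θ') : FibreFn n r)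
          = (1 ⊗ₜ ExteriorAlgebra.map (Matrix.toLin' N.transpose) θ)
            * (1 ⊗ₜ ExteriorAlgebra.map (Matrix.toLin' N.transpose) θ') := by
        rw [Algebra.TensorProduct.tmul_mul_tmul, one_mul, map_mul]
  rw [hφ, hφ, hφ, map_mul, h1, MulMemClass.coe_mul,
        mul_assoc, mul_assoc, ← mul_assoc _ _ (1 ⊗ₜ _), hc, mul_assoc, hc, ← mul_assoc, mul_assoc]

theorem subst_p (hP : ∀ i X, P i * X = X * P i) (N : Matrix (Fin r) (Fin r) ℝ) (i : Fin n) :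
    subst P N (p i) = P i := by
  obtain ⟨φ, h, hφ⟩ := subst_tmul hP N
  rw [p, hφ, h, map_one]
  exact mul_one _

theorem subst_eta (hP : ∀ i X, P i * X = X * P i) (N : Matrix (Fin r) (Fin r) ℝ) (a : Fin r) :
    subst P N (eta a) = linearSum eta (N a) := by
  obtain ⟨φ, h, hφ⟩ := subst_tmul hP N
  have hN : Matrix.toLin' N.transpose (Pi.single a 1) = ∑ d, N a d • Pi.single d (1 : ℝ) := by
    ext d
    simp [Pi.single_apply]
  rw [eta, hφ, map_one, ExteriorAlgebra.map_apply_ι, hN, map_sum, TensorProduct.tmul_sum]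
  refine (one_mul _).trans (Finset.sum_congr rfl fun d _ => ?_)
  rw [map_smul, TensorProduct.tmul_smul, eta]

end FibreFn

namespace LocalFn

variable {n r : ℕ} {M : Type*} [TopologicalSpace M] [ChartedSpace (EuclideanSpace ℝ (Fin n)) M]
  {U : TopologicalSpace.Opens M} (y : U)

theorem evalAt_tmul (f : SmoothFn n U) (X : FibreFn n r) : evalAt y (f ⊗ₜ X) = f y • X := rfl

theorem evalAt_mul (X Y : LocalFn n r U) : evalAt y (X * Y) = evalAt y X * evalAt y Y := by
  refine TensorProduct.map_mul_of_tmul (fun f θ f' θ' => ?_) X Y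
  rw [evalAt_tmul, evalAt_tmul, evalAt_tmul, smul_mul_smul_comm]
  rfl

theorem evalAt_smul (f : SmoothFn n U) (X : LocalFn n r U) :
    evalAt y (f • X) = f y • evalAt y X := by
  rw [← base_mul, evalAt_mul, base, evalAt_tmul, smul_mul_assoc]
  exact congrArg _ (one_mul _)

theorem evalAt_p (i : Fin n) : evalAt y (p i : LocalFn n r U) = FibreFn.p i := by
  rw [p, evalAt_tmul]
  exact one_smul ℝ _

theorem evalAt_eta (a : Fin r) : evalAt y (eta a : LocalFn n r U) = FibreFn.eta a := by
  rw [eta, evalAt_tmul]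
  exact one_smul ℝ _

end LocalFn

end

/-! ### Independence of the Darboux chart -/

noncomputable section

variable {n r : ℕ} {M : Type*} [TopologicalSpace M] [ChartedSpace (EuclideanSpace ℝ (Fin n)) M]
  {V : M → Type*} [TopologicalSpace (Bundle.TotalSpace (EuclideanSpace ℝ (Fin r)) V)]
  [∀ x, AddCommGroup (V x)] [∀ x, Module ℝ (V x)] [∀ x, TopologicalSpace (V x)]
  [FiberBundle (EuclideanSpace ℝ (Fin r)) V] [VectorBundle ℝ (EuclideanSpace ℝ (Fin r)) V]
  {C : CourantAlgebroid (SmoothFn n M) (SmoothSec n r V)}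

namespace DarbouxChart

variable (c c' : DarbouxChart C) (y : M)

/-- The coefficients of `e_d = ∑ a, N a d • e'_a`. -/
def frameChange : Matrix (Fin r) (Fin r) ℝ :=
  fun a d => ∑ b, c'.k⁻¹ a b * (C.pairing (c'.e b) (c.e d)) y

/-- The coefficients of the part of `p'_j` that is quadratic in `η`. -/
def momentumShift (j : Fin n) (a b : Fin r) : ℝ :=
  (1 / 2) * ∑ u, ∑ w, c'.k⁻¹ u w * (c'.field j (C.pairing (c.e a) (c'.e w))) y
    * (C.pairing (c'.e u) (c.e b)) y

/-- The expression of `p'_j` in the coordinates of `c`. -/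
def momentumChange (j : Fin n) : FibreFn n r :=
  ∑ i, (c'.field j (c.x i)) y • FibreFn.p i
    + quadraticSum FibreFn.eta (c.momentumShift c' y j)

theorem transition_eq :
    c.transition c' y = FibreFn.subst (c.momentumChange c' y) (c.frameChange c' y) := by
  rw [transition]
  congr 1
  ext j
  rw [momentumChange]
  congr 1
  simp only [quadraticSum, LinearMap.coe_mk, AddHom.coe_mk, Finset.smul_sum, smul_smul]
  rfl

theorem momentumChange_comm (j : Fin n) (X : FibreFn n r) :
    c.momentumChange c' y j * X = X * c.momentumChange c' y j := by
  have h : c.momentumChange c' y j ∈ Subalgebra.center ℝ (FibreFn n r) := by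
    refine add_mem (sum_mem fun i _ => Subalgebra.smul_mem _ ?_ _) ?_
    · exact Subalgebra.mem_center_iff.mpr fun X => (FibreFn.p_mul i X).symm
    · change (∑ a : Fin r, ∑ b : Fin r, c.momentumShift c' y j a b
        • (FibreFn.eta a * FibreFn.eta b) : FibreFn n r) ∈ _
      exact sum_mem fun a _ => sum_mem fun b _ => Subalgebra.smul_mem _
        (Subalgebra.mem_center_iff.mpr fun X => (FibreFn.eta_mul_eta_comm a b X).symm) _
  exact (Subalgebra.mem_center_iff.mp h X).symm

/-- Functions in the coordinates of `c'`, over `y` and in the coordinates of `c`. -/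
def pullback (hy' : y ∈ c'.U) : LocalFn n r c'.U →+ FibreFn n r :=
  ((c.transition c' y).comp (LocalFn.evalAt ⟨y, hy'⟩)).toAddMonoidHom

variable {y} (hy : y ∈ c.U) (hy' : y ∈ c'.U)

theorem pullback_apply (X : LocalFn n r c'.U) :
    c.pullback c' y hy' X = c.transition c' y (LocalFn.evalAt ⟨y, hy'⟩ X) := rfl

theorem pullback_mul (X Y : LocalFn n r c'.U) :
    c.pullback c' y hy' (X * Y) = c.pullback c' y hy' X * c.pullback c' y hy' Y := by
  rw [pullback_apply, LocalFn.evalAt_mul, transition_eq,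
    FibreFn.subst_mul (c.momentumChange_comm c' y), ← transition_eq]
  rfl

theorem pullback_smul (f : SmoothFn n c'.U) (X : LocalFn n r c'.U) :
    c.pullback c' y hy' (f • X) = f ⟨y, hy'⟩ • c.pullback c' y hy' X := by
  rw [pullback_apply, LocalFn.evalAt_smul, map_smul]
  rfl

theorem pullback_p (j : Fin n) :
    c.pullback c' y hy' (c'.darbouxAlgebra.p j) = c.momentumChange c' y j := by
  rw [pullback_apply]
  refine (congrArg _ (LocalFn.evalAt_p _ j)).trans ?_
  rw [transition_eq, FibreFn.subst_p (c.momentumChange_comm c' y)]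

theorem pullback_η (a : Fin r) : c.pullback c' y hy' (c'.darbouxAlgebra.η a)
    = linearSum FibreFn.eta (c.frameChange c' y a) := by
  rw [pullback_apply]
  refine (congrArg _ (LocalFn.evalAt_eta _ a)).trans ?_
  rw [transition_eq, FibreFn.subst_eta (c.momentumChange_comm c' y)]

section Pointwise

include hy

theorem field_apply (v : VectorFields (SmoothFn n M)) (f : SmoothFn n M) :
    v f y = ∑ i, v (c.x i) y * c.field i f y := by
  have h := congrArg (ContMDiffMap.evalRingHom (⟨y, hy⟩ : c.U)) (c.field_expand v f)
  rw [map_sum] at h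
  exact h

theorem pairing_apply (s t : SmoothSec n r V) : C.pairing s t y
    = ∑ a, ∑ b, c.k⁻¹ a b * (C.pairing s (c.e a) y * C.pairing (c.e b) t y) := by
  have h := congrArg (ContMDiffMap.evalRingHom (⟨y, hy⟩ : c.U)) (c.restr_pairing s t)
  simp only [map_sum] at h
  exact h

theorem anchor_apply (s : SmoothSec n r V) (f : SmoothFn n M) : C.anchor s f y
    = ∑ a, ∑ b, c.k⁻¹ a b * (C.pairing s (c.e a) y * C.anchor (c.e b) f y) := by
  have h := congrArg (ContMDiffMap.evalRingHom (⟨y, hy⟩ : c.U)) (c.restr_anchor_section s f)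
  simp only [map_sum] at h
  exact h

end Pointwise

include hy'

theorem pairing_frame_apply (s : SmoothSec n r V) (d : Fin r) :
    C.pairing s (c.e d) y = ∑ u, c.frameChange c' y u d * C.pairing s (c'.e u) y := by
  rw [c'.pairing_apply hy']
  refine Finset.sum_congr rfl fun u _ => ?_
  rw [frameChange, Finset.sum_mul]
  exact Finset.sum_congr rfl fun b _ => by ring

theorem anchor_frame_apply (d : Fin r) (f : SmoothFn n M) :
    C.anchor (c.e d) f y = ∑ u, c.frameChange c' y u d * C.anchor (c'.e u) f y := by
  rw [c'.anchor_apply hy', Finset.sum_comm]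
  refine Finset.sum_congr rfl fun u _ => ?_
  rw [frameChange, Finset.sum_mul]
  refine Finset.sum_congr rfl fun b _ => ?_
  rw [c'.k_inv_symm ⟨y, hy'⟩, C.pairing_symm]
  ring

/-- `∑ u, ρ(e_a)⟨e'_u, e_b⟩ N u d` at `y`. -/
def frameDerivative (c c' : DarbouxChart C) (y : M) (a b d : Fin r) : ℝ :=
  ∑ u, c.frameChange c' y u d * C.anchor (c.e a) (C.pairing (c'.e u) (c.e b)) y

omit hy' in
theorem momentumShift_eq (hy' : y ∈ c'.U) (j : Fin n) (a b : Fin r) : c.momentumShift c' y j a b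
    = (1 / 2) * ∑ u, c.frameChange c' y u b * c'.field j (C.pairing (c'.e u) (c.e a)) y := by
  rw [momentumShift, Finset.sum_comm]
  congr 1
  refine Finset.sum_congr rfl fun u _ => ?_
  rw [frameChange, Finset.sum_mul]
  refine Finset.sum_congr rfl fun w _ => ?_
  rw [c'.k_inv_symm ⟨y, hy'⟩, C.pairing_symm (c.e a)]
  ring

/-- By the chain rule ∑ ρ_a(x'ʲ) ∂'_j = ρ(e_a). This links the shift of the momenta to the
non-tensorial part of the structure functions. -/
theorem sum_anchor_mul_momentumShift (a b d : Fin r) :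
    ∑ j, C.anchor (c.e a) (c'.x j) y * c.momentumShift c' y j b d
      = (1 / 2) * c.frameDerivative c' y a b d := by
  have h : c.frameDerivative c' y a b d = ∑ u, ∑ j, c.frameChange c' y u d
      * (C.anchor (c.e a) (c'.x j) y * c'.field j (C.pairing (c'.e u) (c.e b)) y) :=
    Finset.sum_congr rfl fun u _ => by rw [c'.field_apply hy' (C.anchor (c.e a)), Finset.mul_sum]
  simp only [c.momentumShift_eq c' hy', h, Finset.mul_sum]
  rw [Finset.sum_comm]
  exact Finset.sum_congr rfl fun u _ => Finset.sum_congr rfl fun j _ => by ring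

/-- Only the last slot of ⟨[e_a, e_b], e_d⟩ is tensorial. The other two are carried to the primed
frame by invariance of the pairing and the rule for the symmetric part of the bracket, and each
exchange leaves derivatives of inner products between the two frames. -/
theorem structureFn_frame_apply (a b d : Fin r) :
    C.pairing (C.dorfman (c.e a) (c.e b)) (c.e d) y
      = c.frameDerivative c' y a b d - c.frameDerivative c' y b a d + c.frameDerivative c' y d a b
        + ∑ u, ∑ v, ∑ w, c'.structureFn u v w ⟨y, hy'⟩
          * (c.frameChange c' y u a * (c.frameChange c' y v b * c.frameChange c' y w d)) := by
  set N := c.frameChange c' y with hN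
  have h1 (w v : Fin r) : C.pairing (C.dorfman (c.e a) (c'.e w)) (c'.e v) y
      = C.anchor (c'.e v) (C.pairing (c'.e w) (c.e a)) y
        - C.anchor (c'.e w) (C.pairing (c'.e v) (c.e a)) y
        - ∑ u, N u a * c'.structureFn u v w ⟨y, hy'⟩ := by
    have e1 := congrArg (fun f : SmoothFn n M => f y)
      (C.pairing_dorfman_left (c.e a) (c'.e w) (c'.e v))
    have e2 := congrArg (fun f : SmoothFn n M => f y)
      (C.pairing_dorfman_right (c'.e w) (c.e a) (c'.e v))
    simp only [ContMDiffMap.coe_sub, Pi.sub_apply] at e1 e2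
    rw [e1, e2, C.pairing_symm (c.e a) (C.dorfman _ _), c.pairing_frame_apply c' hy',
      C.pairing_symm (c.e a), C.pairing_symm (c.e a)]
    have e3 (u : Fin r) : C.pairing (C.dorfman (c'.e w) (c'.e v)) (c'.e u) y
        = -c'.structureFn u v w ⟨y, hy'⟩ := by
      have h := congrArg (fun f : SmoothFn n c'.U => f ⟨y, hy'⟩)
        ((c'.structureFn_rotate w v u).trans (c'.structureFn_swap₂₃ u w v))
      exact h
    simp only [e3, mul_neg, Finset.sum_neg_distrib]
    ring
  have h2 (w : Fin r) : C.pairing (C.dorfman (c.e a) (c.e b)) (c'.e w) y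
      = C.anchor (c.e a) (C.pairing (c'.e w) (c.e b)) y
        - C.anchor (c.e b) (C.pairing (c'.e w) (c.e a)) y
        + ∑ v, N v b * C.anchor (c'.e w) (C.pairing (c'.e v) (c.e a)) y
        + ∑ v, N v b * ∑ u, N u a * c'.structureFn u v w ⟨y, hy'⟩ := by
    have e1 := congrArg (fun f : SmoothFn n M => f y)
      (C.pairing_dorfman_right (c.e a) (c.e b) (c'.e w))
    simp only [ContMDiffMap.coe_sub, Pi.sub_apply] at e1
    rw [e1, C.pairing_symm (c.e b) (C.dorfman _ _), c.pairing_frame_apply c' hy',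
      C.pairing_symm (c.e b), c.anchor_frame_apply c' hy' b]
    simp only [h1, mul_sub, Finset.sum_sub_distrib]
    ring
  have h3 : c.frameDerivative c' y d a b
      = ∑ w, N w d * ∑ v, N v b * C.anchor (c'.e w) (C.pairing (c'.e v) (c.e a)) y := by
    rw [frameDerivative]
    simp only [c.anchor_frame_apply c' hy' d, Finset.mul_sum]
    rw [Finset.sum_comm]
    exact Finset.sum_congr rfl fun w _ => Finset.sum_congr rfl fun v _ => by ring
  have h4 : ∑ u, ∑ v, ∑ w, c'.structureFn u v w ⟨y, hy'⟩ * (N u a * (N v b * N w d))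
      = ∑ w, N w d * ∑ v, N v b * ∑ u, N u a * c'.structureFn u v w ⟨y, hy'⟩ := by
    simp only [Finset.mul_sum]
    calc _ = ∑ u, ∑ w, ∑ v, c'.structureFn u v w ⟨y, hy'⟩ * (N u a * (N v b * N w d)) :=
          Finset.sum_congr rfl fun u _ => Finset.sum_comm
      _ = ∑ w, ∑ v, ∑ u, c'.structureFn u v w ⟨y, hy'⟩ * (N u a * (N v b * N w d)) := by
          rw [Finset.sum_comm]
          exact Finset.sum_congr rfl fun w _ => Finset.sum_comm
      _ = _ := Finset.sum_congr rfl fun w _ => Finset.sum_congr rfl fun v _ =>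
          Finset.sum_congr rfl fun u _ => by ring
  rw [c.pairing_frame_apply c' hy', h3, h4, frameDerivative, frameDerivative]
  simp only [h2, mul_add, mul_sub, Finset.sum_add_distrib, Finset.sum_sub_distrib]
  rfl

/-- The quadratic part of p'_j is exactly the inhomogeneous term in the transformation of ½Γ, so the
covariantized momenta transform without it. -/
theorem connection_frame_apply {D : LinearConnection (SmoothFn n M) (SmoothSec n r V)}
    (hD : C.IsMetricConnection D) (j : Fin n) (a b : Fin r) :
    (1 / 2) * C.pairing (D.cov (c'.field j) (c.e a)) (c.e b) y
      = c.momentumShift c' y j a b + ∑ u, ∑ v, (1 / 2) * c'.connectionCoeff D j u v ⟨y, hy'⟩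
          * (c.frameChange c' y u a * c.frameChange c' y v b) := by
  set N := c.frameChange c' y with hN
  have h1 (v : Fin r) : C.pairing (D.cov (c'.field j) (c.e a)) (c'.e v) y
      = c'.field j (C.pairing (c'.e v) (c.e a)) y
        + ∑ u, N u a * c'.connectionCoeff D j u v ⟨y, hy'⟩ := by
    have e1 := congrArg (fun f : SmoothFn n M => f y) (hD (c'.field j) (c.e a) (c'.e v))
    simp only [ContMDiffMap.coe_add, Pi.add_apply] at e1
    rw [C.pairing_symm (c.e a) (D.cov _ _), c.pairing_frame_apply c' hy',
      C.pairing_symm (c.e a)] at e1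
    have e3 (u : Fin r) : C.pairing (D.cov (c'.field j) (c'.e v)) (c'.e u) y
        = -c'.connectionCoeff D j u v ⟨y, hy'⟩ :=
      congrArg (fun f : SmoothFn n c'.U => f ⟨y, hy'⟩) (c'.connectionCoeff_swap hD j v u)
    simp only [e3, mul_neg, Finset.sum_neg_distrib] at e1
    linear_combination -e1
  rw [c.pairing_frame_apply c' hy', c.momentumShift_eq c' hy']
  simp only [h1, mul_add, Finset.sum_add_distrib, Finset.mul_sum]
  congr 1
  rw [Finset.sum_comm]
  exact Finset.sum_congr rfl fun w _ => Finset.sum_congr rfl fun v _ => by ring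

omit hy'

theorem evalAt_bfvCharge : LocalFn.evalAt ⟨y, hy⟩ c.bfvCharge
    = ∑ i, linearSum FibreFn.eta (fun a => C.anchor (c.e a) (c.x i) y) * FibreFn.p i
      + cubicSum FibreFn.eta (fun a b d =>
        (1 / 6) * C.pairing (C.dorfman (c.e a) (c.e b)) (c.e d) y) := by
  have hη (a : Fin r) : (LocalFn.evalAt ⟨y, hy⟩).toAddMonoidHom (c.darbouxAlgebra.η a)
      = FibreFn.eta a := LocalFn.evalAt_eta _ a
  have hp (j : Fin n) : (LocalFn.evalAt ⟨y, hy⟩).toAddMonoidHom (c.darbouxAlgebra.p j)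
      = (FibreFn.p j : FibreFn n r) := LocalFn.evalAt_p _ j
  rw [c.bfvCharge_eq]
  refine (DarbouxAlgebra.map_charge (φ := (LocalFn.evalAt ⟨y, hy⟩).toAddMonoidHom)
    (χ := fun f : SmoothFn n c.U => f ⟨y, hy⟩) c.darbouxAlgebra (LocalFn.evalAt_mul _)
    (LocalFn.evalAt_smul _) _ _).trans ?_
  simp only [hη, hp]
  rfl

theorem evalAt_bfvHamiltonian (D : LinearConnection (SmoothFn n M) (SmoothSec n r V))
    (g : BaseMetric (SmoothFn n M)) : LocalFn.evalAt ⟨y, hy⟩ (c.bfvHamiltonian D g 0)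
      = (1 / 2 : ℝ) • ∑ i, ∑ l, g.cometric (c.x i) (c.x l) y
        • ((FibreFn.p i + quadraticSum FibreFn.eta
            (fun a b => (1 / 2) * C.pairing (D.cov (c.field i) (c.e a)) (c.e b) y))
          * (FibreFn.p l + quadraticSum FibreFn.eta
            (fun a b => (1 / 2) * C.pairing (D.cov (c.field l) (c.e a)) (c.e b) y))) := by
  have hη (a : Fin r) : (LocalFn.evalAt ⟨y, hy⟩).toAddMonoidHom (c.darbouxAlgebra.η a)
      = FibreFn.eta a := LocalFn.evalAt_eta _ a
  have hp (j : Fin n) : (LocalFn.evalAt ⟨y, hy⟩).toAddMonoidHom (c.darbouxAlgebra.p j)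
      = (FibreFn.p j : FibreFn n r) := LocalFn.evalAt_p _ j
  have hP (F : Fin r → Fin r → SmoothFn n c.U) (j : Fin n) :=
    DarbouxAlgebra.map_shiftedMomentum (φ := (LocalFn.evalAt ⟨y, hy⟩).toAddMonoidHom)
      (χ := fun f : SmoothFn n c.U => f ⟨y, hy⟩) c.darbouxAlgebra (LocalFn.evalAt_mul _)
      (LocalFn.evalAt_smul _) F j
  rw [c.bfvHamiltonian_eq]
  refine (DarbouxAlgebra.map_hamiltonian (φ := (LocalFn.evalAt ⟨y, hy⟩).toAddMonoidHom)
    (χ := fun f : SmoothFn n c.U => f ⟨y, hy⟩) c.darbouxAlgebra (LocalFn.evalAt_mul _)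
    (LocalFn.evalAt_smul _) _ _ _).trans ?_
  simp only [hP, hη, hp]
  rfl

include hy hy'

/-- The linear part in p matches because ρ is a tensor; in the cubic part the shift of the momenta
supplies the missing derivatives of the frame. -/
theorem pullback_bfvCharge :
    c.pullback c' y hy' c'.bfvCharge = LocalFn.evalAt ⟨y, hy⟩ c.bfvCharge := by
  rw [c.evalAt_bfvCharge hy, c'.bfvCharge_eq]
  refine (DarbouxAlgebra.map_charge_of_eq (χ := fun f : SmoothFn n c'.U => f ⟨y, hy'⟩)
    c'.darbouxAlgebra (c.pullback_mul c' hy') (c.pullback_smul c' hy') (c.pullback_η c' hy')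
    (c.pullback_p c' hy') _ _).trans ?_
  have hρ (j : Fin n) (d : Fin r) : ∑ a, c'.anchorCoeff a j ⟨y, hy'⟩ * c.frameChange c' y a d
      = C.anchor (c.e d) (c'.x j) y := by
    rw [c.anchor_frame_apply c' hy' d]
    exact Finset.sum_congr rfl fun a _ => mul_comm _ _
  refine congrArg₂ (fun x y => x + y) (Finset.sum_congr rfl fun i _ => ?_) ?_
  · refine congrArg (fun F => linearSum FibreFn.eta F * FibreFn.p i) (funext fun d => ?_)
    rw [c'.field_apply hy' (C.anchor (c.e d)) (c.x i)]
    exact Finset.sum_congr rfl fun j _ => by rw [hρ]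
  · refine cubicSum_frame_change FibreFn.eta_mul_eta (X := c.frameDerivative c' y)
      fun a b d => ?_
    rw [c.structureFn_frame_apply c' hy', ← c.sum_anchor_mul_momentumShift c' hy']
    simp only [hρ]
    have h : ∑ u, ∑ v, ∑ w, ((1 / 6 : ℝ) • c'.structureFn u v w) ⟨y, hy'⟩
          * (c.frameChange c' y u a * (c.frameChange c' y v b * c.frameChange c' y w d))
        = (1 / 6) * ∑ u, ∑ v, ∑ w, c'.structureFn u v w ⟨y, hy'⟩
          * (c.frameChange c' y u a * (c.frameChange c' y v b * c.frameChange c' y w d)) := by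
      simp only [Finset.mul_sum]
      exact Finset.sum_congr rfl fun u _ => Finset.sum_congr rfl fun v _ =>
        Finset.sum_congr rfl fun w _ => mul_assoc _ _ _
    rw [h]
    ring

variable [T2Space M] [IsManifold (𝓡 n) ∞ M]

/-- Covariantized momenta change by the Jacobian alone, and gⁱʲ by two inverse factors, so the
contraction is invariant. -/
theorem pullback_bfvHamiltonian {D : LinearConnection (SmoothFn n M) (SmoothSec n r V)}
    (hD : C.IsMetricConnection D) (g : BaseMetric (SmoothFn n M)) :
    c.pullback c' y hy' (c'.bfvHamiltonian D g 0)
      = LocalFn.evalAt ⟨y, hy⟩ (c.bfvHamiltonian D g 0) := by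
  have hg (i l : Fin n) : g.cometric (c.x i) (c.x l) y
      = ∑ j, ∑ k, g.cometric (c'.x j) (c'.x k) y
        * (c'.field j (c.x i) y * c'.field k (c.x l) y) := by
    have h1 (k : Fin n) : g.grad (c.x i) (c'.x k) y
        = ∑ j, g.cometric (c'.x j) (c'.x k) y * c'.field j (c.x i) y := by
      have := g.cometric_symm (c.x i) (c'.x k)
      rw [BaseMetric.cometric] at this
      rw [this, BaseMetric.cometric, c'.field_apply hy']
      refine Finset.sum_congr rfl fun j _ => ?_
      rw [g.cometric_symm]
      rfl
    rw [BaseMetric.cometric, c'.field_apply hy']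
    simp only [h1, Finset.sum_mul]
    rw [Finset.sum_comm]
    exact Finset.sum_congr rfl fun j _ => Finset.sum_congr rfl fun k _ => mul_assoc _ _ _
  have hΓ (j : Fin n) (a b : Fin r) : c.momentumShift c' y j a b
        + ∑ u, ∑ v, ((1 / 2 : ℝ) • c'.connectionCoeff D j u v) ⟨y, hy'⟩
            * (c.frameChange c' y u a * c.frameChange c' y v b)
      = ∑ i, c'.field j (c.x i) y
        * ((1 / 2) * C.pairing (D.cov (c.field i) (c.e a)) (c.e b) y) := by
    refine (c.connection_frame_apply c' hy' hD j a b).symm.trans ?_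
    have h := congrArg (ContMDiffMap.evalRingHom (⟨y, hy⟩ : c.U))
      (c.restr_pairing_cov (D := D) (c'.field j) a b)
    rw [map_sum] at h
    refine (congrArg (fun t => (1 / 2) * t) h).trans ?_
    rw [Finset.mul_sum]
    refine Finset.sum_congr rfl fun i _ => ?_
    rw [map_mul]
    exact mul_left_comm _ _ _
  rw [c.evalAt_bfvHamiltonian hy, c'.bfvHamiltonian_eq]
  refine (DarbouxAlgebra.map_hamiltonian_of_eq (χ := fun f : SmoothFn n c'.U => f ⟨y, hy'⟩)
    c'.darbouxAlgebra (c.pullback_mul c' hy') (c.pullback_smul c' hy') fun j =>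
    DarbouxAlgebra.map_shiftedMomentum_of_eq (χ := fun f : SmoothFn n c'.U => f ⟨y, hy'⟩)
      c'.darbouxAlgebra (c.pullback_mul c' hy') (c.pullback_smul c' hy')
      (c.pullback_η c' hy') (c.pullback_p c' hy') (hΓ j)).trans ?_
  refine congrArg₂ (fun (t : ℝ) X => t • X) rfl
    (Finset.sum_congr rfl fun i _ => Finset.sum_congr rfl fun l _ => ?_)
  rw [hg i l]
  rfl

end DarbouxChart

end

theorem mainTheorem7 {n r : ℕ} {M : Type*} [TopologicalSpace M] [T2Space M]
    [SecondCountableTopology M] [ChartedSpace (EuclideanSpace ℝ (Fin n)) M]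
    [IsManifold (𝓡 n) ∞ M]
    {V : M → Type*} [TopologicalSpace (Bundle.TotalSpace (EuclideanSpace ℝ (Fin r)) V)]
    [∀ x, AddCommGroup (V x)] [∀ x, Module ℝ (V x)] [∀ x, TopologicalSpace (V x)]
    [FiberBundle (EuclideanSpace ℝ (Fin r)) V] [VectorBundle ℝ (EuclideanSpace ℝ (Fin r)) V]
    [ContMDiffVectorBundle ∞ (EuclideanSpace ℝ (Fin r)) V (𝓡 n)]
    (C : CourantAlgebroid (SmoothFn n M) (SmoothSec n r V))
    (D : LinearConnection (SmoothFn n M) (SmoothSec n r V)) (hD : C.IsMetricConnection D)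
    (g : BaseMetric (SmoothFn n M)) (hg : C.PreservesMetric D g)
    (hS : C.IsCartan D) :
    ∃ S H : PhaseSpaceFn C,
      (∀ c, S.toLocal c = c.bfvCharge) ∧
      (∀ c, H.toLocal c = c.bfvHamiltonian D g 0) ∧
      BFVEquations S H := by
  refine ⟨⟨fun c => c.bfvCharge, fun c c' y hy hy' => c.pullback_bfvCharge c' hy hy'⟩,
    ⟨fun c => c.bfvHamiltonian D g 0, fun c c' y hy hy' =>
      c.pullback_bfvHamiltonian c' hy hy' hD g⟩, fun _ => rfl, fun _ => rfl, fun c =>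
    ⟨c.poisson_bfvCharge_bfvCharge, c.poisson_bfvCharge_bfvHamiltonian hD hS hg,
      c.poisson_bfvHamiltonian_bfvHamiltonian hD g⟩⟩
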